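/- **Theorem 3.2.** Let $B$ be an infinite Boolean algebra of uniform density. Then $B$ is a Cohen algebra if and only if the set $$\{A \in [B]^{\omega} : A \le_{\mathrm{reg}} B\}$$ contains a closed unbounded set $C \subseteq [B]^{\omega}$ with the property $$\text{if } A_1, A_2 \in C, \text{ then } \langle A_1 \cup A_2\rangle \in C .$$ Here a set $D \subseteq B$ is *dense* if for every $b \neq 0$ in $B$ there is $d \in D$ with $0 < d \le b$; the *density* of $B$ is the least cardinality of a dense subset; and $B$ has *uniform density* if for every $a \ne 0$ in $B$ the relative algebra $B \upharpoonright a = \{x \in B : x \le a\}$ has the same density as $B$. The *completion* $\overline{B}$ is the complete Boolean algebra, unique up to isomorphism, that contains $B$ as a dense subalgebra, and $B$ is a *Cohen algebra* if $\overline{B}$ is isomorphic to $\mathbf{C}_\kappa$, the completion of the free Boolean algebra on $\kappa$ generators, for some infinite cardinal $\kappa$. $[B]^{\omega}$ is the set of all countable subsets of $B$; a set $C \subseteq [B]^{\omega}$ is *closed unbounded* if the union of every nonempty countable chain of members of $C$ belongs to $C$ and every $x \in [B]^{\omega}$ is contained in some $y \in C$. $A \le_{\mathrm{reg}} B$ means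 that $A$ is a *regular subalgebra* of $B$, i.e. a subalgebra such that for every $X \subseteq A$ that has a supremum $\sum^A X$ in $A$, this element is also the supremum of $X$ in $B$. Finally, $\langle X\rangle$ is the subalgebra of $B$ generated by $X$. -/

import Mathlib

universe u

namespace CohenAlgebra

section Basic

variable {B : Type u}

/-- `D` is dense in `B`: below every nonzero element of `B` there is a nonzero element of `D`. -/
def IsDense [PartialOrder B] [OrderBot B] (D : Set B) : Prop :=
  ∀ b : B, b ≠ ⊥ → ∃ d ∈ D, d ≠ ⊥ ∧ d ≤ b

/-- The density of `B`: the least cardinality of a dense subset. -/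
noncomputable def density (B : Type u) [PartialOrder B] [OrderBot B] : Cardinal.{u} :=
  sInf {κ | ∃ D : Set B, IsDense D ∧ Cardinal.mk D = κ}

/-- `B` has uniform density: for every nonzero `a`, the relative algebra `B ↾ a`, carried by
`{x | x ≤ a}`, has the same density as `B`. -/
def HasUniformDensity (B : Type u) [BooleanAlgebra B] : Prop :=
  ∀ a : B, a ≠ ⊥ → density (Set.Iic a) = density B

/-- `A` is a regular subalgebra of `B`: whenever a subset `X` of `A` has a supremum in `A`, that
element is also the supremum of `X` in `B`. -/
def IsRegularSubalgebra [BooleanAlgebra B] (A : BooleanSubalgebra B) : Prop :=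
  ∀ (X : Set A) (a : A), IsLUB X a → IsLUB ((fun x : A => (x : B)) '' X) (a : B)

/-- `C` is a closed unbounded subset of `[B]^ω`: it consists of countable sets, every countable set
is contained in a member of `C`, and `C` is closed under unions of nonempty countable chains. -/
structure IsClosedUnbounded (C : Set (Set B)) : Prop where
  countable : ∀ x ∈ C, x.Countable
  unbounded : ∀ x : Set B, x.Countable → ∃ y ∈ C, x ⊆ y
  closed : ∀ D : Set (Set B), D ⊆ C → D.Nonempty → D.Countable →
    IsChain (fun x y => x ⊆ y) D → ⋃₀ D ∈ C

end Basic

section Free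

variable (X : Type u)

/-- The coordinate set `{f | f x = 1}` in `{0,1}^X`. -/
def coord (x : X) : Set (X → Bool) := {f | f x = true}

/-- The free Boolean algebra over `X`, realized as the algebra of sets generated by the coordinate
sets in `{0,1}^X` (equivalently, the clopen subsets of `{0,1}^X`). -/
abbrev Fr : Type u := BooleanSubalgebra.closure (Set.range (coord X))

/-- The generators of the free algebra are independent: any finite intersection of distinct
generators and complements of other generators is nonzero. -/
theorem coord_independent (s t : Finset X) (h : Disjoint s t) :
    (⋂ x ∈ s, coord X x) ∩ (⋂ x ∈ t, (coord X x)ᶜ) ≠ ∅ := by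
  classical
  rw [← Set.nonempty_iff_ne_empty]
  refine ⟨fun x => decide (x ∈ s), ?_, ?_⟩
  · simp [coord]
  · simp only [coord, Set.mem_iInter, Set.mem_compl_iff, Set.mem_ofPred_eq, decide_eq_true_eq]
    exact fun x hx hs => Finset.disjoint_left.1 h hs hx

end Free

section Completion

variable (B : Type u) [BooleanAlgebra B]

/-- The completion of `B`, realized as the algebra of regular open subsets of the poset of nonzero
elements of `B`: the lower sets of nonzero elements that are equal to their double complement. -/
abbrev Completion : Type u := Heyting.Regular (LowerSet {b : B // b ≠ ⊥})

/-- The completion is a complete Boolean algebra. -/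
noncomputable instance Completion.instCompleteBooleanAlgebra :
    CompleteBooleanAlgebra (Completion B) :=
  { (inferInstance : BooleanAlgebra (Completion B)),
    (Heyting.Regular.gi (α := LowerSet {b : B // b ≠ ⊥})).liftCompleteLattice with }

variable {B}

theorem mem_compl_iff (U : LowerSet {b : B // b ≠ ⊥}) (c : {b : B // b ≠ ⊥}) :
    c ∈ Uᶜ ↔ ∀ d ≤ c, d ∉ U := by
  rw [← LowerSet.Iic_le, le_compl_iff_disjoint_right, disjoint_iff_inf_le]
  constructor
  · intro h d hd hU
    exact h (show d ∈ LowerSet.Iic c ⊓ U from ⟨hd, hU⟩)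
  · rintro h d ⟨hd, hU⟩
    exact (h d hd hU).elim

/-- The lower set of all nonzero elements below `b`. -/
def below (b : B) : LowerSet {b : B // b ≠ ⊥} := ⟨{c | c.1 ≤ b}, fun _ _ h h' => le_trans h h'⟩

theorem mem_below {b : B} {c : {b : B // b ≠ ⊥}} : c ∈ below b ↔ c.1 ≤ b := Iff.rfl

theorem below_compl (b : B) : below bᶜ = (below b)ᶜ := by
  ext c
  change c ∈ below bᶜ ↔ c ∈ (below b)ᶜ
  rw [mem_compl_iff, mem_below, le_compl_iff_disjoint_right]
  constructor
  · intro h d hd hb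
    exact d.2 (le_bot_iff.1 (h hd hb))
  · intro h
    rw [disjoint_iff]
    by_contra h0
    exact h ⟨c.1 ⊓ b, h0⟩ (show c.1 ⊓ b ≤ c.1 from inf_le_left)
      (show c.1 ⊓ b ≤ b from inf_le_right)

/-- The canonical map of `B` into its completion. -/
def toCompletion (b : B) : Completion B :=
  ⟨below b, by rw [Heyting.IsRegular, ← below_compl, ← below_compl, compl_compl]⟩

theorem toCompletion_le_iff {a b : B} : toCompletion a ≤ toCompletion b ↔ a ≤ b := by
  constructor
  · intro h
    by_cases ha : a = ⊥
    · simp [ha]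
    · exact (show below a ≤ below b from h) (show (⟨a, ha⟩ : {b : B // b ≠ ⊥}) ∈ below a from le_rfl)
  · intro h c hc
    exact le_trans (show c.1 ≤ a from hc) h

theorem toCompletion_inf (a b : B) :
    toCompletion (a ⊓ b) = toCompletion a ⊓ toCompletion b := by
  refine le_antisymm (le_inf (toCompletion_le_iff.2 inf_le_left)
    (toCompletion_le_iff.2 inf_le_right)) ?_
  rintro c ⟨h1, h2⟩
  exact le_inf (show c.1 ≤ a from h1) h2

theorem toCompletion_compl (a : B) : toCompletion aᶜ = (toCompletion a)ᶜ :=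
  Heyting.Regular.coe_injective (below_compl a)

/-- `B` is dense in its completion. -/
theorem isDense_range_toCompletion : IsDense (Set.range (toCompletion (B := B))) := by
  intro U hU
  obtain ⟨c, hc⟩ : ∃ c, c ∈ U.val := by
    by_contra h
    push Not at h
    exact hU (le_bot_iff.1 fun c hc => (h c hc).elim)
  refine ⟨toCompletion c.1, ⟨c.1, rfl⟩, fun h => ?_, fun d hd => U.val.lower hd hc⟩
  have h1 : c ∈ (toCompletion c.1).val := show c.1 ≤ c.1 from le_rfl
  rw [h] at h1
  exact h1

end Completion

/-- The complete Boolean algebra `C_X` that adjoins `X` Cohen reals: the completion of `Fr_X`. -/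
abbrev CohenCompletion (X : Type u) : Type u := Completion (Fr X)

/-- `B` is a Cohen algebra if its completion is isomorphic to `C_X` for some infinite `X`. -/
def IsCohen (B : Type u) [BooleanAlgebra B] : Prop :=
  ∃ X : Type u, Infinite X ∧ Nonempty (Completion B ≃o CohenCompletion X)

end CohenAlgebra

/-!
Both directions compare the completion of `B` with that of a free algebra through dense families.

**From a Cohen algebra to a club.** If `B` is dense in a complete algebra in which `Fr X` is dense
as well, the club consists of the countable subalgebras `A` of `B` for which there is a set `S ⊆ X`
such that `A` is dense in the algebra of elements supported by `S` (`IsAdapted`). Such an `A` is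
regular because a cylinder and its restriction to `S` are compatible with the same cylinders on `S`.
The set `S` is determined by `A`, monotonically (`IsAdapted.subset_of_le`), which gives closure
under chains. The join of algebras adapted to `S` and `S'` is adapted to `S ∪ S'`
(`IsAdapted.closure_union`). The family is cofinal because, by the countable chain condition, every
element has a countable support.

**From a club to a Cohen algebra.** A club `C` of regular subalgebras forces the countable chain
condition, and it makes every subalgebra generated by members of `C` regular: closure under joins
makes it a directed union of members of `C`, so a predense subset can be tested on one countable
member of `C` (`IsRegularClub.exists_predense`). A dense subset of `B` of least size is now absorbed
along a well-order, one member of `C` at a time. At every stage the subalgebra `D` generated so far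
has fewer elements than the density of `B`, so by uniform density it is nowhere dense in `B`, and
the next member `A` of `C` can be chosen so that the algebra generated by `D` and `A` is nowhere
trivial over `D` (`IsRegularClub.exists_splitsOver`). As `A` is countable, this extension adds a
Cohen real to `D`: splitting the unit successively along an enumeration of `A`, while keeping all
pieces compatible with every nonzero element of `D`, gives a binary tree that is independent of `D`
and, together with `D`, generates a dense set (`exists_tree`). The trees of all stages together form
an independent family with a dense set of finite meets (`isCohenSystem_of_chain`). A free algebra on
`I × ℕ` has such a family too, and the completion is determined by the family
(`IsCohenSystem.nonempty_orderIso`).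
-/

namespace CohenAlgebra

/-! ### Dense families and regular subalgebras -/

section Generic

variable {B : Type u} [BooleanAlgebra B]

theorem exists_pairwiseDisjoint_predense (P : Set B) (hP : ∀ p ∈ P, p ≠ ⊥) :
    ∃ W ⊆ P, W.PairwiseDisjoint id ∧ ∀ p ∈ P, ∃ w ∈ W, ¬Disjoint w p := by
  obtain ⟨W, hW⟩ := zorn_subset {W : Set B | W ⊆ P ∧ W.PairwiseDisjoint id} (by
    intro c hc hchain
    refine ⟨⋃₀ c, ⟨Set.sUnion_subset fun s hs => (hc hs).1, ?_⟩, fun s hs =>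
      Set.subset_sUnion_of_mem hs⟩
    exact (Set.pairwiseDisjoint_sUnion hchain.directedOn).2 fun s hs => (hc hs).2)
  refine ⟨W, hW.prop.1, hW.prop.2, fun p hp => ?_⟩
  by_contra! h
  have hmem : insert p W ∈ {W : Set B | W ⊆ P ∧ W.PairwiseDisjoint id} :=
    ⟨Set.insert_subset hp hW.prop.1, hW.prop.2.insert fun w hw _ => (h w hw).symm⟩
  exact hP p hp (disjoint_self.1 (h p (hW.le_of_ge hmem (Set.subset_insert _ _)
    (Set.mem_insert _ _))))

/-- Regularity in terms of predense sets: `A` is regular in `B` if and only if every `X ⊆ A` that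
meets each nonzero element of `A` meets each nonzero element of `B`. -/
theorem isRegularSubalgebra_iff {A : BooleanSubalgebra B} :
    IsRegularSubalgebra A ↔ ∀ X ⊆ (A : Set B), (∀ a ∈ A, a ≠ ⊥ → ∃ x ∈ X, ¬Disjoint x a) →
      ∀ b : B, b ≠ ⊥ → ∃ x ∈ X, ¬Disjoint x b := by
  constructor
  · intro hA X hXA hX b hb
    have h1 : IsLUB ((↑) ⁻¹' X : Set A) (⊤ : A) := by
      refine ⟨fun _ _ => le_top, fun y hy => ?_⟩
      by_contra hne
      have hyc : ((yᶜ : A) : B) ≠ ⊥ := fun h => hne (by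
        have : yᶜ = ⊥ := Subtype.ext h
        rw [compl_eq_bot.1 this])
      obtain ⟨x, hx, hxy⟩ := hX _ (yᶜ).2 hyc
      have h2 : (⟨x, hXA hx⟩ : A) ≤ y := hy hx
      exact hxy (disjoint_compl_right.mono_left (show x ≤ (y : B) from h2))
    have h2 := hA _ _ h1
    by_contra! h
    have : (⊤ : B) ≤ bᶜ := h2.2 (by
      rintro _ ⟨x, hx, rfl⟩
      exact (h _ hx).le_compl_right)
    exact hb (compl_eq_top.1 (top_le_iff.1 this))
  · intro hA X a hX
    refine ⟨?_, fun b hb => ?_⟩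
    · rintro _ ⟨x, hx, rfl⟩
      exact hX.1 hx
    · by_contra hab
      have hne : (a : B) ⊓ bᶜ ≠ ⊥ := fun h => hab (by
        rwa [← disjoint_iff, disjoint_compl_right_iff] at h)
      obtain ⟨x, hx, hxb⟩ := hA (insert (a : B)ᶜ ((fun x : A => (x : B)) '' X)) (by
          rintro _ (rfl | ⟨x, -, rfl⟩)
          exacts [A.compl_mem a.2, x.2]) (by
          intro c hc hc0
          by_contra! h
          have h1 : c ≤ a := by
            have := h _ (Set.mem_insert _ _)
            rw [disjoint_comm] at this
            simpa using this.le_compl_right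
          have h2 : a ≤ (⟨c, hc⟩ : A)ᶜ := hX.2 fun x hx =>
            (h x (Set.mem_insert_of_mem _ ⟨x, hx, rfl⟩)).le_compl_right
          exact hc0 (disjoint_self.1 (le_compl_iff_disjoint_right.1
            (h1.trans (show (a : B) ≤ cᶜ from h2))))) _ hne
      rcases hx with rfl | ⟨x, hx, rfl⟩
      · exact hxb (disjoint_compl_left.mono_right inf_le_left)
      · exact hxb (disjoint_compl_right.mono (hb ⟨x, hx, rfl⟩) inf_le_right)

theorem isRegularSubalgebra_bot : IsRegularSubalgebra (⊥ : BooleanSubalgebra B) := by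
  refine isRegularSubalgebra_iff.2 fun X hX h b hb => ?_
  have htop : (⊤ : B) ≠ ⊥ := fun h => hb (le_bot_iff.1 (h ▸ le_top))
  obtain ⟨x, hx, hx'⟩ := h ⊤ BooleanSubalgebra.top_mem htop
  rcases hX hx with rfl | rfl
  · simp at hx'
  · exact ⟨_, hx, by simpa using hb⟩

theorem IsRegularSubalgebra.map {B' : Type u} [BooleanAlgebra B'] {A : BooleanSubalgebra B}
    (hA : IsRegularSubalgebra A) (j : BoundedLatticeHom B B') (hj : Function.Injective j)
    (hd : IsDense (Set.range j)) : IsRegularSubalgebra (A.map j) := by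
  have h0 : ∀ a, j a = ⊥ ↔ a = ⊥ := fun a => by rw [← map_bot j, hj.eq_iff]
  have hdis : ∀ a b, Disjoint (j a) (j b) ↔ Disjoint a b := fun a b => by
    rw [disjoint_iff, disjoint_iff, ← map_inf, h0]
  refine isRegularSubalgebra_iff.2 fun X hX h b hb => ?_
  obtain ⟨_, ⟨c, rfl⟩, hc, hcb⟩ := hd b hb
  obtain ⟨x, hx, hxc⟩ := isRegularSubalgebra_iff.1 hA (A ∩ j ⁻¹' X) Set.inter_subset_left (by
    intro a ha ha0
    obtain ⟨y, hy, hya⟩ := h (j a) ⟨a, ha, rfl⟩ (by rwa [Ne, h0])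
    obtain ⟨x, hx, rfl⟩ := hX hy
    exact ⟨x, ⟨hx, hy⟩, by rwa [← hdis]⟩) c (by rwa [Ne, ← h0])
  exact ⟨j x, hx.2, fun hd => hxc ((hdis _ _).1 (hd.mono_right hcb))⟩

end Generic

/-- If `f` and `g` have the same incompatible indices and `f` is dense, then no `g q` lies below
`⨆ {g p | f p ≤ a}` except those with `f q ≤ a`. -/
theorem iSup_iSup_eq_of_dense {P 𝔸 𝔹 : Type*} [CompleteBooleanAlgebra 𝔸]
    [CompleteBooleanAlgebra 𝔹] {f : P → 𝔸} {g : P → 𝔹} (hf0 : ∀ p, f p ≠ ⊥)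
    (hf : ∀ a, a ≠ ⊥ → ∃ p, f p ≤ a)
    (hfg : ∀ p q, Disjoint (f p) (f q) ↔ Disjoint (g p) (g q)) (a : 𝔸) :
    ⨆ q, ⨆ _ : g q ≤ ⨆ p, ⨆ _ : f p ≤ a, g p, f q = a := by
  have h1 : ∀ q, g q ≤ (⨆ p, ⨆ _ : f p ≤ a, g p) ↔ f q ≤ a := by
    intro q
    refine ⟨fun hq => ?_, fun hq => le_iSup₂_of_le q hq le_rfl⟩
    by_contra hqa
    obtain ⟨r, hr⟩ := hf (f q ⊓ aᶜ) (fun h => hqa (by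
      rwa [← disjoint_iff, disjoint_compl_right_iff] at h))
    have h2 : Disjoint (g r) (⨆ p, ⨆ _ : f p ≤ a, g p) := by
      simp only [disjoint_iSup_iff]
      intro p hp
      rw [← hfg]
      exact disjoint_compl_left.mono (hr.trans inf_le_right) hp
    exact hf0 r (disjoint_self.1 (((hfg r q).2 (h2.mono_right hq)).mono_right
      (hr.trans inf_le_left)))
  simp only [h1]
  refine le_antisymm (iSup₂_le fun _ h => h) ?_
  by_contra hne
  obtain ⟨r, hr⟩ := hf (a ⊓ (⨆ q, ⨆ _ : f q ≤ a, f q)ᶜ) (fun h => hne (by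
    rwa [← disjoint_iff, disjoint_compl_right_iff] at h))
  exact hf0 r (disjoint_self.1 (disjoint_compl_right.mono
    (le_iSup₂_of_le r (hr.trans inf_le_left) le_rfl) (hr.trans inf_le_right)))

/-- Two complete Boolean algebras with dense families of nonzero elements, indexed by the same type
and having the same pairs of incompatible indices, are isomorphic. -/
theorem nonempty_orderIso_of_dense {P 𝔸 𝔹 : Type*} [CompleteBooleanAlgebra 𝔸]
    [CompleteBooleanAlgebra 𝔹] (f : P → 𝔸) (g : P → 𝔹) (hf0 : ∀ p, f p ≠ ⊥) (hg0 : ∀ p, g p ≠ ⊥)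
    (hf : ∀ a, a ≠ ⊥ → ∃ p, f p ≤ a) (hg : ∀ b, b ≠ ⊥ → ∃ p, g p ≤ b)
    (hfg : ∀ p q, Disjoint (f p) (f q) ↔ Disjoint (g p) (g q)) : Nonempty (𝔸 ≃o 𝔹) :=
  ⟨{toFun := fun a => ⨆ p, ⨆ _ : f p ≤ a, g p
    invFun := fun b => ⨆ p, ⨆ _ : g p ≤ b, f p
    left_inv := iSup_iSup_eq_of_dense hf0 hf hfg
    right_inv := iSup_iSup_eq_of_dense hg0 hg fun p q => (hfg p q).symm
    map_rel_iff' := by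
      intro a b
      refine ⟨fun h => ?_, fun h => iSup₂_le fun p hp => le_iSup₂_of_le p (hp.trans h) le_rfl⟩
      rw [← iSup_iSup_eq_of_dense hf0 hf hfg a, ← iSup_iSup_eq_of_dense hf0 hf hfg b]
      exact iSup₂_le fun p hp => le_iSup₂_of_le p (hp.trans h) le_rfl }⟩

section Split

variable {𝔹 : Type u} [CompleteBooleanAlgebra 𝔹]

/-- The complete subalgebra generated by a regular subalgebra `D` of a complete Boolean algebra:
the suprema of subsets of `D`, described as the elements `x` such that everything meeting `x` meets
an element of `D` below `x`. -/
def completeHull (D : BooleanSubalgebra 𝔹) (hD : IsRegularSubalgebra D) :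
    BooleanSubalgebra 𝔹 where
  carrier := {x | ∀ b, ¬Disjoint b x → ∃ d ∈ D, d ≤ x ∧ ¬Disjoint b d}
  bot_mem' := fun b hb => (hb disjoint_bot_right).elim
  supClosed' := by
    intro x hx y hy b hb
    rw [disjoint_sup_right, not_and_or] at hb
    rcases hb with hb | hb
    · obtain ⟨d, hd, h1, h2⟩ := hx b hb
      exact ⟨d, hd, le_sup_of_le_left h1, h2⟩
    · obtain ⟨d, hd, h1, h2⟩ := hy b hb
      exact ⟨d, hd, le_sup_of_le_right h1, h2⟩
  infClosed' := by
    intro x hx y hy b hb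
    obtain ⟨d, hd, h1, h2⟩ := hx (b ⊓ y) (by rwa [disjoint_assoc, inf_comm y x])
    obtain ⟨d', hd', h1', h2'⟩ := hy (b ⊓ d) (by rwa [disjoint_right_comm])
    exact ⟨d ⊓ d', D.inf_mem hd hd', inf_le_inf h1 h1', by rwa [← disjoint_assoc]⟩
  compl_mem' := by
    intro x hx b hb
    obtain ⟨d, hd, h⟩ := isRegularSubalgebra_iff.1 hD {d | d ∈ D ∧ (d ≤ x ∨ d ≤ xᶜ)}
      (fun d hd => hd.1) (by
        intro d hd hd0
        by_cases h : Disjoint d x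
        · exact ⟨d, ⟨hd, Or.inr h.le_compl_right⟩, by simpa using hd0⟩
        · obtain ⟨d', hd', h1, h2⟩ := hx d h
          exact ⟨d', ⟨hd', Or.inl h1⟩, fun h => h2 h.symm⟩) (b ⊓ xᶜ) (by rwa [Ne, ← disjoint_iff])
    rcases hd.2 with h1 | h1
    · exact (h (disjoint_compl_right.mono h1 inf_le_right)).elim
    · exact ⟨d, hd.1, h1, fun h' => h (h'.symm.mono_right inf_le_left)⟩

variable {D E : BooleanSubalgebra 𝔹}

theorem le_completeHull (hD : IsRegularSubalgebra D) : D ≤ completeHull D hD :=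
  fun d hd _ hb => ⟨d, hd, le_rfl, hb⟩

theorem sSup_mem_completeHull (hD : IsRegularSubalgebra D) {S : Set 𝔹}
    (hS : ∀ x ∈ S, x ∈ completeHull D hD) : sSup S ∈ completeHull D hD := by
  intro b hb
  rw [disjoint_sSup_iff] at hb
  push Not at hb
  obtain ⟨x, hx, hbx⟩ := hb
  obtain ⟨d, hd, h1, h2⟩ := hS x hx b hbx
  exact ⟨d, hd, h1.trans (le_sSup hx), h2⟩

/-- `u` is full over `D`: it meets every nonzero element of `D`. -/
def IsFull (D : BooleanSubalgebra 𝔹) (u : 𝔹) : Prop := ∀ d ∈ D, d ≠ ⊥ → ¬Disjoint d u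

/-- `E` is nowhere trivial over `D`: no nonzero `b ∈ E` is such that the traces `d ⊓ b`, `d ∈ D`,
are dense in `E` below `b`. -/
def NowhereTrivial (D E : BooleanSubalgebra 𝔹) : Prop :=
  ∀ b ∈ E, b ≠ ⊥ → ∃ e ∈ E, e ≠ ⊥ ∧ e ≤ b ∧ ∀ d ∈ D, d ⊓ b ≤ e → d ⊓ b = ⊥

/-- An element that is full over `D` can be split into two elements that are full over `D`: locally
this is `NowhereTrivial`, and the local splittings are glued along a maximal antichain of `D`. -/
theorem IsFull.exists_split (hD : IsRegularSubalgebra D) (hE : IsRegularSubalgebra E) (hDE : D ≤ E)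
    (hn : NowhereTrivial D E) {u : 𝔹} (hu : u ∈ completeHull E hE) (hf : IsFull D u) :
    ∃ v ∈ completeHull E hE, v ≤ u ∧ IsFull D v ∧ IsFull D (u \ v) := by
  set P : Set 𝔹 := {d | d ∈ D ∧ d ≠ ⊥ ∧ ∃ v ∈ E, v ≤ u ∧ ∀ d' ∈ D, d' ≤ d → d' ≠ ⊥ →
    ¬Disjoint d' v ∧ ¬Disjoint d' (u \ v)} with hP
  have hdense : ∀ d₀ ∈ D, d₀ ≠ ⊥ → ∃ d ∈ P, d ≤ d₀ := by
    intro d₀ hd₀ h0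
    obtain ⟨e₀, he₀, he₀u, hmeet⟩ := hu d₀ (hf d₀ hd₀ h0)
    obtain ⟨e, he, hene, heb, htriv⟩ := hn (d₀ ⊓ e₀) (E.inf_mem (hDE hd₀) he₀)
      (by rwa [Ne, ← disjoint_iff])
    -- regularity of `D` provides an element of `D` all of whose nonzero parts in `D` meet `e`
    obtain ⟨d₁, hd₁, hd₁e, hd₁'⟩ : ∃ d₁ ∈ D, ¬Disjoint d₁ e ∧
        ∀ d ∈ D, d ≤ d₁ → d ≠ ⊥ → ¬Disjoint d e := by
      by_contra! hcon
      obtain ⟨x, hx, hxe⟩ := isRegularSubalgebra_iff.1 hD {d | d ∈ D ∧ Disjoint d e}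
        (fun d hd => hd.1) (by
          intro d hd hdne
          by_cases hde : Disjoint d e
          · exact ⟨d, ⟨hd, hde⟩, by simpa using hdne⟩
          · obtain ⟨d', hd', h1, h2, h3⟩ := hcon d hd hde
            exact ⟨d', ⟨hd', h3⟩, fun h => h2 (disjoint_self.1 (h.mono_right h1))⟩) e hene
      exact hxe hx.2
    refine ⟨d₁ ⊓ d₀, ⟨D.inf_mem hd₁ hd₀, fun h => hd₁e ?_, e, he, ?_, ?_⟩, inf_le_right⟩
    · exact (disjoint_iff.2 h).mono_right (heb.trans inf_le_left)
    · exact heb.trans (inf_le_right.trans he₀u)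
    · intro d hd hdle hd0
      have hde := hd₁' d hd (hdle.trans inf_le_left) hd0
      refine ⟨hde, fun h => ?_⟩
      have h1 : d ⊓ (d₀ ⊓ e₀) ≤ e := by
        rw [sdiff_eq, disjoint_iff, ← inf_assoc, ← disjoint_iff, disjoint_compl_right_iff] at h
        exact (inf_le_inf_left d (inf_le_right.trans he₀u)).trans h
      exact hde ((disjoint_iff.2 (htriv d hd h1)).mono_right heb)
  obtain ⟨W, hWP, hWd, hWm⟩ := exists_pairwiseDisjoint_predense P fun p hp => hp.2.1
  have hWD : ∀ d ∈ D, d ≠ ⊥ → ∃ w ∈ W, ¬Disjoint w d := by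
    intro d hd hd0
    obtain ⟨p, hp, hpd⟩ := hdense d hd hd0
    obtain ⟨w, hw, hwp⟩ := hWm p hp
    exact ⟨w, hw, fun h => hwp (h.mono_right hpd)⟩
  have hv : ∀ w : 𝔹, ∃ v, w ∈ W → v ∈ E ∧ v ≤ u ∧ ∀ d' ∈ D, d' ≤ w → d' ≠ ⊥ →
      ¬Disjoint d' v ∧ ¬Disjoint d' (u \ v) := by
    intro w
    by_cases hw : w ∈ W
    · obtain ⟨-, -, v, h1, h2, h3⟩ := hWP hw
      exact ⟨v, fun _ => ⟨h1, h2, h3⟩⟩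
    · exact ⟨⊥, fun h => (hw h).elim⟩
  choose v hv using hv
  set V : 𝔹 := sSup ((fun w => v w ⊓ w) '' W) with hV
  have hVw : ∀ w ∈ W, V ⊓ w ≤ v w := by
    intro w hw
    rw [hV, sSup_image, iSup₂_inf_eq]
    refine iSup₂_le fun w' hw' => ?_
    by_cases h : w' = w
    · subst h
      exact inf_le_left.trans inf_le_left
    · have : Disjoint w' w := hWd hw' hw h
      rw [inf_assoc, this.eq_bot, inf_bot_eq]
      exact bot_le
  refine ⟨V, sSup_mem_completeHull hE ?_, sSup_le ?_, ?_, ?_⟩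
  · rintro _ ⟨w, hw, rfl⟩
    exact le_completeHull hE (E.inf_mem (hv w hw).1 (hDE (hWP hw).1))
  · rintro _ ⟨w, hw, rfl⟩
    exact inf_le_left.trans (hv w hw).2.1
  · intro d hd hd0 h
    obtain ⟨w, hw, hwd⟩ := hWD d hd hd0
    refine ((hv w hw).2.2 (w ⊓ d) (D.inf_mem (hWP hw).1 hd) inf_le_left
      (by rwa [Ne, ← disjoint_iff])).1 ?_
    have h1 : v w ⊓ w ≤ V := le_sSup ⟨w, hw, rfl⟩
    rw [inf_comm, disjoint_assoc, inf_comm]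
    exact h.mono_right h1
  · intro d hd hd0 h
    obtain ⟨w, hw, hwd⟩ := hWD d hd hd0
    refine ((hv w hw).2.2 (w ⊓ d) (D.inf_mem (hWP hw).1 hd) inf_le_left
      (by rwa [Ne, ← disjoint_iff])).2 ?_
    rw [inf_comm, disjoint_assoc]
    refine h.mono_right ?_
    rw [sdiff_eq, sdiff_eq]
    refine le_inf (inf_le_right.trans inf_le_left) ?_
    rw [le_compl_iff_disjoint_right, disjoint_iff, eq_bot_iff]
    calc w ⊓ (u ⊓ (v w)ᶜ) ⊓ V ≤ (V ⊓ w) ⊓ (v w)ᶜ :=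
          le_inf (le_inf inf_le_right (inf_le_left.trans inf_le_left))
            (inf_le_left.trans (inf_le_right.trans inf_le_right))
      _ ≤ v w ⊓ (v w)ᶜ := inf_le_inf_right _ (hVw w hw)
      _ = ⊥ := inf_compl_self _

/-- A full element `u` can be split into full halves so that, moreover, locally in `D` the half `v`
lies below a prescribed `a ∈ E` wherever `a` meets `u`. -/
theorem IsFull.exists_split_deciding (hD : IsRegularSubalgebra D) (hE : IsRegularSubalgebra E)
    (hDE : D ≤ E) (hn : NowhereTrivial D E) {u : 𝔹} (hu : u ∈ completeHull E hE) (hf : IsFull D u)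
    {a : 𝔹} (ha : a ∈ E) :
    ∃ v ∈ completeHull E hE, v ≤ u ∧ IsFull D v ∧ IsFull D (u \ v) ∧
      ∀ d ∈ D, ¬Disjoint d (a ⊓ u) → ∃ d' ∈ D, d' ≤ d ∧ d' ≠ ⊥ ∧ d' ⊓ v ≤ a := by
  obtain ⟨v₀, hv₀, hv₀u, hv₀f, hv₀f'⟩ := hf.exists_split hD hE hDE hn hu
  -- Off `p ⊔ q` both `u ⊓ a` and `u \ a` are full; on `p ⊔ q` an arbitrary splitting is used.
  set p : 𝔹 := sSup {d | d ∈ D ∧ Disjoint d (u ⊓ a)} with hp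
  set q : 𝔹 := sSup {d | d ∈ D ∧ Disjoint d (u ⊓ aᶜ)} with hq
  have hpD : p ∈ completeHull D hD := sSup_mem_completeHull hD fun d hd => le_completeHull hD hd.1
  have hqD : q ∈ completeHull D hD := sSup_mem_completeHull hD fun d hd => le_completeHull hD hd.1
  have hrD := (completeHull D hD).sup_mem hpD hqD
  have hsub : ∀ x, x ∈ completeHull D hD → x ∈ completeHull E hE := by
    intro x hx b hb
    obtain ⟨d, hd, h⟩ := hx b hb
    exact ⟨d, hDE hd, h⟩
  set r := p ⊔ q with hr
  have hrE := hsub r hrD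
  have haE := le_completeHull hE ha
  set v : 𝔹 := (u ⊓ a) ⊓ rᶜ ⊔ v₀ ⊓ r with hv
  have hpu : Disjoint p (u ⊓ a) := by
    rw [hp, sSup_disjoint_iff]
    exact fun d hd => hd.2
  have hvr : v ⊓ rᶜ = u ⊓ a ⊓ rᶜ := by
    rw [hv, inf_sup_right, inf_assoc, inf_idem, inf_assoc v₀, inf_compl_self, inf_bot_eq,
      sup_bot_eq]
  have hvu : v ≤ u := sup_le (inf_le_left.trans inf_le_left) (inf_le_left.trans hv₀u)
  have hle1 : v₀ ⊓ r ≤ v := le_sup_right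
  have hle2 : (u \ v₀) ⊓ r ≤ u \ v := by
    rw [sdiff_eq, sdiff_eq]
    refine le_inf (inf_le_left.trans inf_le_left) ?_
    rw [le_compl_iff_disjoint_right, hv, disjoint_sup_right]
    constructor
    · exact disjoint_compl_right.mono inf_le_right inf_le_right
    · exact disjoint_compl_left.mono (inf_le_left.trans inf_le_right) inf_le_left
  have hle3 : u ⊓ aᶜ ⊓ rᶜ ≤ u \ v := by
    rw [sdiff_eq]
    refine le_inf (inf_le_left.trans inf_le_left) ?_
    rw [le_compl_iff_disjoint_right, hv, disjoint_sup_right]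
    constructor
    · exact disjoint_compl_left.mono (inf_le_left.trans inf_le_right)
        (inf_le_left.trans inf_le_right)
    · exact disjoint_compl_left.mono inf_le_right inf_le_right
  have full_aux : ∀ x y z : 𝔹, IsFull D x → x ⊓ r ≤ z → y ⊓ rᶜ ≤ z →
      (∀ d ∈ D, Disjoint d y → d ≤ r) → IsFull D z := by
    intro x y z hx hxz hyz hy d hd hd0 hdz
    by_cases hdr : Disjoint d r
    · have h1 : d ≤ rᶜ := hdr.le_compl_right
      have h2 : Disjoint d y := by
        rw [disjoint_iff, eq_bot_iff, ← disjoint_iff.1 hdz]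
        exact le_inf inf_le_left
          ((le_inf inf_le_right (inf_le_left.trans h1)).trans hyz)
      exact hd0 (disjoint_self.1 (hdr.mono_right (hy d hd h2)))
    · obtain ⟨d', hd', h1, h2⟩ := hrD d hdr
      refine hx (d ⊓ d') (D.inf_mem hd hd') (by rwa [Ne, ← disjoint_iff]) ?_
      rw [disjoint_assoc]
      exact hdz.mono_right ((le_inf inf_le_right (inf_le_left.trans h1)).trans hxz)
  refine ⟨v, ?_, hvu, ?_, ?_, ?_⟩
  · exact BooleanSubalgebra.sup_mem (BooleanSubalgebra.inf_mem (BooleanSubalgebra.inf_mem hu haE)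
      (BooleanSubalgebra.compl_mem hrE)) (BooleanSubalgebra.inf_mem hv₀ hrE)
  · exact full_aux v₀ (u ⊓ a) v hv₀f hle1 le_sup_left fun d hd h =>
      le_sup_of_le_left (le_sSup ⟨hd, h⟩)
  · exact full_aux (u \ v₀) (u ⊓ aᶜ) (u \ v) hv₀f' hle2 hle3 fun d hd h =>
      le_sup_of_le_right (le_sSup ⟨hd, h⟩)
  · intro d hd h
    by_cases hdq : Disjoint d q
    · have h1 : ¬Disjoint d rᶜ := by
        intro h'
        rw [disjoint_compl_right_iff] at h'
        have h2 : d ≤ p := hdq.left_le_of_le_sup_right h'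
        refine h (hpu.mono h2 ?_)
        rw [inf_comm]
      obtain ⟨d', hd', hd'r, hdd'⟩ := (completeHull D hD).compl_mem hrD d h1
      refine ⟨d ⊓ d', D.inf_mem hd hd', inf_le_left, by rwa [Ne, ← disjoint_iff], ?_⟩
      calc d ⊓ d' ⊓ v ≤ v ⊓ rᶜ := le_inf inf_le_right (inf_le_left.trans (inf_le_right.trans hd'r))
        _ = u ⊓ a ⊓ rᶜ := hvr
        _ ≤ a := inf_le_left.trans inf_le_right
    · rw [hq, disjoint_sSup_iff] at hdq
      push Not at hdq
      obtain ⟨d', hd', hdd'⟩ := hdq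
      refine ⟨d ⊓ d', D.inf_mem hd hd'.1, inf_le_left, by rwa [Ne, ← disjoint_iff], ?_⟩
      have h1 := hd'.2
      rw [disjoint_iff, ← inf_assoc, ← disjoint_iff, disjoint_compl_right_iff] at h1
      exact (inf_le_inf inf_le_right hvu).trans h1

/-- If `E` is a regular extension of `D` that is countably generated over `D`, in the sense of
density, and nowhere trivial over `D`, then `E` is `D` with a Cohen real adjoined: there is a full
binary tree of elements of the completion of `E` that are independent of `D` and generate, together
with `D`, a dense set. -/
theorem exists_tree (hD : IsRegularSubalgebra D) (hE : IsRegularSubalgebra E) (hDE : D ≤ E)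
    (hn : NowhereTrivial D E) (a : ℕ → 𝔹) (ha : ∀ n, a n ∈ E)
    (hgen : ∀ e ∈ E, e ≠ ⊥ → ∃ d ∈ D, ∃ n, ¬Disjoint d (a n) ∧ d ⊓ a n ≤ e) :
    ∃ u : List Bool → 𝔹, (∀ b s, u (b :: s) ≤ u s) ∧
      (∀ s, Disjoint (u (true :: s)) (u (false :: s))) ∧
      (∀ s, ∀ d ∈ D, d ≠ ⊥ → ∃ e ∈ E, e ≠ ⊥ ∧ e ≤ d ⊓ u s) ∧
      (∀ e ∈ E, e ≠ ⊥ → ∃ d ∈ D, d ≠ ⊥ ∧ ∃ s, d ⊓ u s ≤ e) := by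
  have hs : ∀ (u : 𝔹) (n : ℕ), ∃ v, u ∈ completeHull E hE → IsFull D u →
      v ∈ completeHull E hE ∧ v ≤ u ∧ IsFull D v ∧ IsFull D (u \ v) ∧
      ∀ d ∈ D, ¬Disjoint d (a n ⊓ u) → ∃ d' ∈ D, d' ≤ d ∧ d' ≠ ⊥ ∧ d' ⊓ v ≤ a n := by
    intro u n
    by_cases h : u ∈ completeHull E hE ∧ IsFull D u
    · obtain ⟨v, hv⟩ := h.2.exists_split_deciding hD hE hDE hn h.1 (ha n)
      exact ⟨v, fun _ _ => hv⟩
    · exact ⟨⊥, fun h1 h2 => (h ⟨h1, h2⟩).elim⟩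
  choose f hf using hs
  obtain ⟨u, hu0, hu⟩ : ∃ u : List Bool → 𝔹, u [] = ⊤ ∧ ∀ b s, u (b :: s) =
      bif b then f (u s) s.length else u s \ f (u s) s.length :=
    ⟨fun l => List.rec ⊤ (fun b s x => bif b then f x s.length else x \ f x s.length) l, rfl,
      fun _ _ => rfl⟩
  have hut : ∀ s, u (true :: s) = f (u s) s.length := fun s => hu true s
  have huf : ∀ s, u (false :: s) = u s \ f (u s) s.length := fun s => hu false s
  have hmem : ∀ s, u s ∈ completeHull E hE ∧ IsFull D (u s) := by
    intro s
    induction s with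
    | nil =>
      rw [hu0]
      exact ⟨BooleanSubalgebra.top_mem, fun d _ hd0 => by simpa using hd0⟩
    | cons b s ih =>
      obtain ⟨h1, h2, h3, h4, -⟩ := hf (u s) s.length ih.1 ih.2
      cases b
      · rw [huf]
        exact ⟨BooleanSubalgebra.sdiff_mem ih.1 h1, h4⟩
      · rw [hut]
        exact ⟨h1, h3⟩
  have hcover : ∀ (n : ℕ) (x : 𝔹), x ≠ ⊥ → ∃ s, s.length = n ∧ ¬Disjoint x (u s) := by
    intro n
    induction n with
    | zero => exact fun x hx => ⟨[], rfl, by simpa [hu0] using hx⟩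
    | succ n ih =>
      intro x hx
      obtain ⟨s, hs, hxs⟩ := ih x hx
      have hsup : u (true :: s) ⊔ u (false :: s) = u s := by
        rw [hut, huf, sup_sdiff_cancel_right (hf _ _ (hmem s).1 (hmem s).2).2.1]
      rw [← hsup, disjoint_sup_right, not_and_or] at hxs
      rcases hxs with h | h
      exacts [⟨_, by simp [hs], h⟩, ⟨_, by simp [hs], h⟩]
  refine ⟨u, ?_, ?_, ?_, ?_⟩
  · intro b s
    cases b
    · rw [huf]
      exact sdiff_le
    · rw [hut]
      exact (hf _ _ (hmem s).1 (hmem s).2).2.1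
  · intro s
    rw [hut, huf]
    exact disjoint_sdiff_self_right
  · intro s d hd hd0
    obtain ⟨e, he, heu, hde⟩ := (hmem s).1 d ((hmem s).2 d hd hd0)
    exact ⟨d ⊓ e, E.inf_mem (hDE hd) he, by rwa [Ne, ← disjoint_iff], inf_le_inf_left _ heu⟩
  · intro e he he0
    obtain ⟨d, hd, n, hdn, hle⟩ := hgen e he he0
    obtain ⟨s, rfl, hs⟩ := hcover n (d ⊓ a n) (by rwa [Ne, ← disjoint_iff])
    obtain ⟨d', hd', h1, h2, h3⟩ := (hf _ _ (hmem s).1 (hmem s).2).2.2.2.2 d hd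
      (by rwa [← disjoint_assoc])
    refine ⟨d', hd', h2, true :: s, le_trans (le_inf (inf_le_left.trans h1) ?_) hle⟩
    rw [hut]
    exact h3

end Split

/-! ### Cohen systems: independent families of binary trees -/

section System

variable {I : Type u} {𝔸 𝔹 : Type u}

/-- A family of binary trees in a Boolean algebra, indexed by `I`, that is independent and generates
a dense subset. A node is a finite binary sequence, extended at the head of the list. The basic
clopen sets of `({0,1}^ℕ)^I` form the standard example. -/
structure IsCohenSystem [BooleanAlgebra 𝔹] (u : I → List Bool → 𝔹) : Prop where
  cons_le : ∀ i b s, u i (b :: s) ≤ u i s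
  disjoint : ∀ i s, Disjoint (u i (true :: s)) (u i (false :: s))
  inf_ne_bot : ∀ (F : Finset I) (t : I → List Bool), F.inf (fun i => u i (t i)) ≠ ⊥
  dense : ∀ b : 𝔹, b ≠ ⊥ → ∃ (F : Finset I) (t : I → List Bool), F.inf (fun i => u i (t i)) ≤ b

namespace IsCohenSystem

variable [BooleanAlgebra 𝔹] {u : I → List Bool → 𝔹}

theorem append_le (hu : IsCohenSystem u) (i : I) (l s : List Bool) : u i (l ++ s) ≤ u i s := by
  induction l with
  | nil => exact le_rfl
  | cons b l ih => exact (hu.cons_le i b _).trans ih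

theorem le_of_suffix (hu : IsCohenSystem u) (i : I) {s t : List Bool} (h : s <:+ t) :
    u i t ≤ u i s := by
  obtain ⟨l, rfl⟩ := h
  exact hu.append_le i l s

theorem disjoint_of_not_suffix (hu : IsCohenSystem u) (i : I) {s t : List Bool}
    (h : ¬s <:+ t) (h' : ¬t <:+ s) : Disjoint (u i s) (u i t) := by
  induction s with
  | nil => exact (h List.nil_suffix).elim
  | cons b s ih =>
    have hts : ¬t <:+ s := fun h1 => h' (h1.trans (List.suffix_cons b s))
    by_cases hst : s <:+ t
    · obtain ⟨l, rfl⟩ := hst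
      rcases List.eq_nil_or_concat l with rfl | ⟨l, c, rfl⟩
      · exact (hts (by simp)).elim
      · rw [List.concat_append] at h h' ⊢
        have hcb : c ≠ b := by
          rintro rfl
          exact h (List.suffix_append _ _)
        refine Disjoint.mono_right (hu.append_le i l (c :: s)) ?_
        cases b <;> cases c
        · exact (hcb rfl).elim
        · exact (hu.disjoint i s).symm
        · exact hu.disjoint i s
        · exact (hcb rfl).elim
    · exact (ih hst hts).mono_left (hu.cons_le i b s)

theorem disjoint_inf_iff (hu : IsCohenSystem u) (F G : Finset I) (s t : I → List Bool) :
    Disjoint (F.inf fun i => u i (s i)) (G.inf fun i => u i (t i)) ↔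
      ∃ i ∈ F, i ∈ G ∧ ¬s i <:+ t i ∧ ¬t i <:+ s i := by
  classical
  constructor
  · intro h
    by_contra! hcon
    -- the longer of the two sequences is taken at each index
    let r : I → List Bool := fun i =>
      if i ∈ F then (if i ∈ G then (if s i <:+ t i then t i else s i) else s i) else t i
    refine hu.inf_ne_bot (F ∪ G) r (le_bot_iff.1 (h ?_ ?_))
    · refine Finset.le_inf fun i hi => (Finset.inf_le (Finset.mem_union_left G hi)).trans ?_
      simp only [r, hi, if_true]
      split_ifs with h1 h2
      · exact hu.le_of_suffix i h2
      · exact le_rfl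
      · exact le_rfl
    · refine Finset.le_inf fun i hi => (Finset.inf_le (Finset.mem_union_right F hi)).trans ?_
      simp only [r, hi, if_true]
      split_ifs with h1 h2
      · exact le_rfl
      · exact hu.le_of_suffix i (hcon i h1 hi h2)
      · exact le_rfl
  · rintro ⟨i, hF, hG, h1, h2⟩
    exact (hu.disjoint_of_not_suffix i h1 h2).mono (Finset.inf_le hF) (Finset.inf_le hG)

end IsCohenSystem

theorem IsCohenSystem.nonempty_orderIso [CompleteBooleanAlgebra 𝔸] [CompleteBooleanAlgebra 𝔹]
    {u : I → List Bool → 𝔸} {v : I → List Bool → 𝔹} (hu : IsCohenSystem u)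
    (hv : IsCohenSystem v) : Nonempty (𝔸 ≃o 𝔹) := by
  refine nonempty_orderIso_of_dense
    (fun p : Finset I × (I → List Bool) => p.1.inf fun i => u i (p.2 i))
    (fun p : Finset I × (I → List Bool) => p.1.inf fun i => v i (p.2 i))
    (fun p => hu.inf_ne_bot p.1 p.2) (fun p => hv.inf_ne_bot p.1 p.2)
    (fun a ha => ?_) (fun a ha => ?_)
    (fun p q => (hu.disjoint_inf_iff p.1 q.1 p.2 q.2).trans
      (hv.disjoint_inf_iff p.1 q.1 p.2 q.2).symm)
  · obtain ⟨F, t, h⟩ := hu.dense a ha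
    exact ⟨(F, t), h⟩
  · obtain ⟨F, t, h⟩ := hv.dense a ha
    exact ⟨(F, t), h⟩

/-- Trees obtained along a well-ordered chain of extensions `closure (⋃ j < i, A j)`, each adding a
Cohen real to the previous one, form a Cohen system. -/
theorem isCohenSystem_of_chain [BooleanAlgebra 𝔹] [Nontrivial 𝔹] [LinearOrder I]
    [WellFoundedLT I] (A : I → Set 𝔹) (u : I → List Bool → 𝔹)
    (hcons : ∀ i b s, u i (b :: s) ≤ u i s)
    (hdisj : ∀ i s, Disjoint (u i (true :: s)) (u i (false :: s)))
    (hfull : ∀ i s, ∀ d ∈ BooleanSubalgebra.closure (⋃ j ∈ Set.Iio i, A j), d ≠ ⊥ →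
      ∃ e ∈ BooleanSubalgebra.closure (⋃ j ∈ Set.Iic i, A j), e ≠ ⊥ ∧ e ≤ d ⊓ u i s)
    (hdense : ∀ i, ∀ e ∈ BooleanSubalgebra.closure (⋃ j ∈ Set.Iic i, A j), e ≠ ⊥ →
      ∃ d ∈ BooleanSubalgebra.closure (⋃ j ∈ Set.Iio i, A j), d ≠ ⊥ ∧ ∃ s, d ⊓ u i s ≤ e)
    (hA : ∀ b : 𝔹, b ≠ ⊥ → ∃ i, ∃ e ∈ A i, e ≠ ⊥ ∧ e ≤ b) : IsCohenSystem u := by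
  classical
  have hmono : ∀ {s t : Set I}, s ⊆ t → BooleanSubalgebra.closure (⋃ j ∈ s, A j) ≤
      BooleanSubalgebra.closure (⋃ j ∈ t, A j) := fun h =>
    BooleanSubalgebra.closure_mono (Set.biUnion_subset_biUnion_left h)
  -- the finite meet with largest index `i` contains a nonzero element of the `i`-th algebra
  have hindep : ∀ (t : I → List Bool) (F : Finset I), ∃ e ∈ BooleanSubalgebra.closure
      (⋃ j ∈ {j | ∃ i ∈ F, j ≤ i}, A j), e ≠ ⊥ ∧ e ≤ F.inf (fun i => u i (t i)) := by
    intro t F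
    induction F using Finset.induction_on_max with
    | empty => exact ⟨⊤, BooleanSubalgebra.top_mem, top_ne_bot, by simp⟩
    | insert i F hi ih =>
      obtain ⟨e, he, he0, hle⟩ := ih
      obtain ⟨e', he', he0', hle'⟩ := hfull i (t i) e (hmono (by
        rintro j ⟨k, hk, hjk⟩
        exact hjk.trans_lt (hi k hk)) he) he0
      refine ⟨e', hmono (fun j hj =>
        (⟨i, Finset.mem_insert_self _ _, hj⟩ : ∃ k ∈ insert i F, j ≤ k)) he', he0', ?_⟩
      rw [Finset.inf_insert]
      exact le_inf (hle'.trans inf_le_right) ((hle'.trans inf_le_left).trans hle)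
  have hdir : ∀ i, ∀ d ∈ BooleanSubalgebra.closure (⋃ j ∈ Set.Iio i, A j),
      d = ⊥ ∨ d = ⊤ ∨ ∃ j < i, d ∈ BooleanSubalgebra.closure (⋃ k ∈ Set.Iic j, A k) := by
    intro i d hd
    induction hd using BooleanSubalgebra.closure_bot_sup_induction with
    | mem x hx =>
      obtain ⟨j, hj, hx⟩ := Set.mem_iUnion₂.1 hx
      exact Or.inr (Or.inr ⟨j, hj, BooleanSubalgebra.subset_closure
        (Set.mem_iUnion₂.2 ⟨j, Set.mem_Iic.2 le_rfl, hx⟩)⟩)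
    | bot => exact Or.inl rfl
    | sup x _ y _ hx hy =>
      rcases hx with rfl | rfl | ⟨j, hj, hx⟩
      · simpa using hy
      · simp
      · rcases hy with rfl | rfl | ⟨k, hk, hy⟩
        · exact Or.inr (Or.inr ⟨j, hj, by simpa using hx⟩)
        · simp
        · exact Or.inr (Or.inr ⟨max j k, max_lt hj hk, BooleanSubalgebra.sup_mem
            (hmono (Set.Iic_subset_Iic.2 (le_max_left _ _)) hx)
            (hmono (Set.Iic_subset_Iic.2 (le_max_right _ _)) hy)⟩)
    | compl x _ hx =>
      rcases hx with rfl | rfl | ⟨j, hj, hx⟩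
      · simp
      · simp
      · exact Or.inr (Or.inr ⟨j, hj, BooleanSubalgebra.compl_mem hx⟩)
  have hbelow : ∀ i, ∀ e ∈ BooleanSubalgebra.closure (⋃ j ∈ Set.Iic i, A j), e ≠ ⊥ →
      ∃ (F : Finset I) (t : I → List Bool), (∀ j ∈ F, j ≤ i) ∧
        F.inf (fun i => u i (t i)) ≤ e := by
    intro i
    induction i using WellFoundedLT.induction with
    | ind i ih =>
      intro e he he0
      obtain ⟨d, hd, hd0, s, hs⟩ := hdense i e he he0
      rcases hdir i d hd with rfl | rfl | ⟨j, hj, hd'⟩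
      · exact (hd0 rfl).elim
      · exact ⟨{i}, fun _ => s, by simp, by simpa using hs⟩
      · obtain ⟨F, t, hF, hle⟩ := ih j hj d hd' hd0
        refine ⟨insert i F, Function.update t i s, ?_, ?_⟩
        · intro k hk
          rcases Finset.mem_insert.1 hk with rfl | hk
          exacts [le_rfl, (hF k hk).trans hj.le]
        · rw [Finset.inf_insert, Function.update_self]
          refine le_trans (le_inf (inf_le_right.trans (le_trans ?_ hle)) inf_le_left) hs
          refine Finset.le_inf fun k hk => (Finset.inf_le hk).trans ?_
          rw [Function.update_of_ne ((hF k hk).trans_lt hj).ne]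
  refine ⟨hcons, hdisj, fun F t h => ?_, fun b hb => ?_⟩
  · obtain ⟨e, -, he0, hle⟩ := hindep t F
    exact he0 (le_bot_iff.1 (h ▸ hle))
  · obtain ⟨i, e, he, he0, hle⟩ := hA b hb
    obtain ⟨F, t, -, h⟩ := hbelow i e (BooleanSubalgebra.subset_closure
      (Set.mem_iUnion₂.2 ⟨i, Set.mem_Iic.2 le_rfl, he⟩)) he0
    exact ⟨F, t, h.trans hle⟩

end System

/-! ### The free algebra and its completion -/

section Completion

variable {B 𝔸 : Type u} [BooleanAlgebra B]

/-- A map of Boolean algebras that preserves meets and complements, as a homomorphism. -/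
def homOfInfCompl [BooleanAlgebra 𝔸] (f : B → 𝔸) (hinf : ∀ a b, f (a ⊓ b) = f a ⊓ f b)
    (hcompl : ∀ a, f aᶜ = (f a)ᶜ) : BoundedLatticeHom B 𝔸 where
  toFun := f
  map_sup' a b := by
    rw [← compl_compl (a ⊔ b), compl_sup, hcompl, hinf, hcompl, hcompl, compl_inf, compl_compl,
      compl_compl]
  map_inf' := hinf
  map_top' := by rw [← compl_bot, ← inf_compl_self (⊥ : B), hcompl, hinf, hcompl, inf_compl_self,
    compl_bot]
  map_bot' := by rw [← inf_compl_self (⊥ : B), hinf, hcompl, inf_compl_self]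

variable (B) in
/-- The completion of `B`, as a complete Boolean algebra with a dense embedding of `B`. -/
theorem exists_denseEmbedding : ∃ (𝔸 : Type u) (_ : CompleteBooleanAlgebra 𝔸)
    (j : BoundedLatticeHom B 𝔸), Function.Injective j ∧ IsDense (Set.range j) ∧
      Nonempty (Completion B ≃o 𝔸) :=
  ⟨Completion B, inferInstance, homOfInfCompl toCompletion toCompletion_inf toCompletion_compl,
    fun _ _ h => le_antisymm (toCompletion_le_iff.1 (le_of_eq h))
      (toCompletion_le_iff.1 (ge_of_eq h)),
    isDense_range_toCompletion, ⟨OrderIso.refl _⟩⟩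

variable [BooleanAlgebra 𝔸] {j : BoundedLatticeHom B 𝔸}

theorem hom_eq_bot (hj : Function.Injective j) {b : B} : j b = ⊥ ↔ b = ⊥ := by
  rw [← map_bot j, hj.eq_iff]

theorem disjoint_hom (hj : Function.Injective j) {a b : B} :
    Disjoint (j a) (j b) ↔ Disjoint a b := by
  rw [disjoint_iff, disjoint_iff, ← map_inf, hom_eq_bot hj]

theorem hom_le (hj : Function.Injective j) {a b : B} : j a ≤ j b ↔ a ≤ b := by
  rw [← inf_eq_left, ← inf_eq_left, ← map_inf, hj.eq_iff]

theorem exists_hom_le (hj : Function.Injective j) (hd : IsDense (Set.range j)) {x : 𝔸}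
    (hx : x ≠ ⊥) : ∃ b : B, b ≠ ⊥ ∧ j b ≤ x := by
  obtain ⟨_, ⟨b, rfl⟩, hb, hbx⟩ := hd x hx
  exact ⟨b, fun h => hb ((hom_eq_bot hj).2 h), hbx⟩

end Completion

section Cylinder

variable {X : Type u}

theorem coord_mem (x : X) : coord X x ∈ BooleanSubalgebra.closure (Set.range (coord X)) := BooleanSubalgebra.subset_closure ⟨x, rfl⟩

/-- The cylinder of all points that agree with `x` on the finite set `F`, as an element of the free
algebra. -/
def cyl (F : Finset X) (x : X → Bool) : Fr X :=
  ⟨{y | ∀ i ∈ F, y i = x i}, by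
    classical
    induction F using Finset.induction_on with
    | empty =>
      have : {y : X → Bool | ∀ k ∈ (∅ : Finset X), y k = x k} = ⊤ := by
        ext y
        simp
      rw [this]
      exact BooleanSubalgebra.top_mem
    | insert i F _ ih =>
      have : {y : X → Bool | ∀ k ∈ insert i F, y k = x k} =
          (if x i then coord X i else (coord X i)ᶜ) ⊓ {y | ∀ k ∈ F, y k = x k} := by
        ext y
        simp only [Finset.mem_insert, forall_eq_or_imp, Set.mem_ofPred_eq, Set.inf_eq_inter,
          Set.mem_inter_iff]
        refine and_congr_left fun _ => ?_
        cases h : x i <;> simp [coord]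
      rw [this]
      refine BooleanSubalgebra.inf_mem ?_ ih
      split_ifs
      exacts [coord_mem i, BooleanSubalgebra.compl_mem (coord_mem i)]⟩

theorem mem_cyl {F : Finset X} {x y : X → Bool} :
    y ∈ (cyl F x : Set (X → Bool)) ↔ ∀ i ∈ F, y i = x i := Iff.rfl

theorem fr_ne_bot_iff {f : Fr X} : f ≠ ⊥ ↔ (f : Set (X → Bool)).Nonempty := by
  rw [Set.nonempty_iff_ne_empty]
  exact not_congr (Subtype.ext_iff (a2 := (⊥ : Fr X)))

theorem cyl_ne_bot (F : Finset X) (x : X → Bool) : cyl F x ≠ ⊥ :=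
  fr_ne_bot_iff.2 ⟨x, fun _ _ => rfl⟩

theorem exists_cyl_subset {f : Set (X → Bool)} 
    (hf : f ∈ BooleanSubalgebra.closure (Set.range (coord X))) :
    ∀ x, ∃ F : Finset X, (cyl F x : Set (X → Bool)) ⊆ f ∨ (cyl F x : Set (X → Bool)) ⊆ fᶜ := by
  classical
  induction hf using BooleanSubalgebra.closure_bot_sup_induction with
  | mem f hf =>
    obtain ⟨i, rfl⟩ := hf
    intro x
    refine ⟨{i}, ?_⟩
    cases h : x i
    · right
      intro y hy
      simp [coord, (mem_cyl.1 hy i (by simp)), h]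
    · left
      intro y hy
      simp [coord, (mem_cyl.1 hy i (by simp)), h]
  | bot => exact fun x => ⟨∅, Or.inr (by simp)⟩
  | sup f _ g _ hf hg =>
    intro x
    obtain ⟨F, hF⟩ := hf x
    obtain ⟨G, hG⟩ := hg x
    have h1 : (cyl (F ∪ G) x : Set (X → Bool)) ⊆ cyl F x := fun y hy i hi =>
      hy i (Finset.mem_union_left _ hi)
    have h2 : (cyl (F ∪ G) x : Set (X → Bool)) ⊆ cyl G x := fun y hy i hi =>
      hy i (Finset.mem_union_right _ hi)
    refine ⟨F ∪ G, ?_⟩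
    rcases hF with hF | hF
    · exact Or.inl ((h1.trans hF).trans Set.subset_union_left)
    · rcases hG with hG | hG
      · exact Or.inl ((h2.trans hG).trans Set.subset_union_right)
      · right
        rw [compl_sup]
        exact Set.subset_inter (h1.trans hF) (h2.trans hG)
  | compl f _ hf =>
    intro x
    obtain ⟨F, hF⟩ := hf x
    exact ⟨F, by rw [compl_compl]; exact hF.symm⟩

theorem exists_cyl_le {f : Fr X} (hf : f ≠ ⊥) : ∃ F x, cyl F x ≤ f := by
  obtain ⟨x, hx⟩ := fr_ne_bot_iff.1 hf
  obtain ⟨F, hF | hF⟩ := exists_cyl_subset f.2 x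
  · exact ⟨F, x, hF⟩
  · exact (hF (fun _ _ => rfl : x ∈ (cyl F x : Set (X → Bool))) hx).elim

theorem disjoint_cyl_iff {F G : Finset X} {x y : X → Bool} :
    Disjoint (cyl F x) (cyl G y) ↔ ∃ i ∈ F, i ∈ G ∧ x i ≠ y i := by
  classical
  rw [disjoint_iff, ← not_iff_not, ← Ne, fr_ne_bot_iff]
  push Not
  constructor
  · rintro ⟨z, h1, h2⟩ i hF hG
    rw [← h1 i hF, h2 i hG]
  · intro h
    refine ⟨fun i => if i ∈ F then x i else y i, fun i hi => by simp [hi], fun i hi => ?_⟩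
    by_cases hF : i ∈ F
    · simp [hF, h i hF hi]
    · simp [hF]

theorem cyl_le_cyl_iff {F G : Finset X} {x y : X → Bool} :
    cyl F x ≤ cyl G y ↔ G ⊆ F ∧ ∀ i ∈ G, x i = y i := by
  classical
  constructor
  · intro h
    refine ⟨fun i hi => ?_, fun i hi => ?_⟩
    · by_contra hF
      -- changing `x` at a coordinate outside `F` leads out of the second cylinder
      have := h (show Function.update x i (!y i) ∈ (cyl F x : Set (X → Bool)) from
        fun k hk => Function.update_of_ne (fun hki : k = i => hF (hki ▸ hk)) _ _) i hi
      simp at this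
    · exact h (fun _ _ => rfl : x ∈ (cyl F x : Set (X → Bool))) i hi
  · rintro ⟨h1, h2⟩ z hz i hi
    rw [hz i (h1 hi), h2 i hi]

end Cylinder

section StandardSystem

variable {I : Type u}

/-- The tree of initial segments of the `i`-th real in the free algebra on `I × ℕ`. -/
def stdTree (i : I) : List Bool → Fr (I × ℕ)
  | [] => ⊤
  | b :: s => cyl {(i, s.length)} (fun _ => b) ⊓ stdTree i s

theorem mem_stdTree_cons {i : I} {b : Bool} {s : List Bool} {x : I × ℕ → Bool} :
    x ∈ (stdTree i (b :: s) : Set (I × ℕ → Bool)) ↔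
      x (i, s.length) = b ∧ x ∈ (stdTree i s : Set (I × ℕ → Bool)) := by
  have h : x ∈ (cyl {(i, s.length)} (fun _ => b) : Set (I × ℕ → Bool)) ↔ x (i, s.length) = b := by
    rw [mem_cyl]
    simp
  exact and_congr_left' h

theorem exists_forall_mem_stdTree (s : List Bool) : ∃ y : ℕ → Bool, ∀ (i : I) (x : I × ℕ → Bool),
    (∀ n < s.length, x (i, n) = y n) → x ∈ (stdTree i s : Set (I × ℕ → Bool)) := by
  induction s with
  | nil => exact ⟨fun _ => true, fun i x _ => Set.mem_univ _⟩
  | cons b s ih =>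
    obtain ⟨y, hy⟩ := ih
    refine ⟨Function.update y s.length b, fun i x hx => mem_stdTree_cons.2 ⟨?_, hy i x ?_⟩⟩
    · simpa using hx s.length (by simp)
    · intro n hn
      simpa [hn.ne] using hx n (by simp; omega)

theorem exists_stdTree_forall (y : ℕ → Bool) (n : ℕ) : ∃ s : List Bool, s.length = n ∧
    ∀ (i : I) (x : I × ℕ → Bool), x ∈ (stdTree i s : Set (I × ℕ → Bool)) →
      ∀ k < n, x (i, k) = y k := by
  induction n with
  | zero => exact ⟨[], rfl, by simp⟩
  | succ n ih =>
    obtain ⟨s, rfl, hs⟩ := ih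
    refine ⟨y s.length :: s, by simp, fun i x hx k hk => ?_⟩
    rw [mem_stdTree_cons] at hx
    rcases (Nat.lt_succ_iff_lt_or_eq.1 hk) with h | rfl
    · exact hs i x hx.2 k h
    · exact hx.1

theorem mem_finset_inf_stdTree {F : Finset I} {t : I → List Bool} {x : I × ℕ → Bool} :
    x ∈ ((F.inf fun i => stdTree i (t i) : Fr (I × ℕ)) : Set (I × ℕ → Bool)) ↔
      ∀ i ∈ F, x ∈ (stdTree i (t i) : Set (I × ℕ → Bool)) := by
  classical
  induction F using Finset.induction_on with
  | empty => simp
  | insert i F _ ih => simp [Finset.inf_insert, ih]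

theorem isCohenSystem_stdTree {𝔸 : Type u} [BooleanAlgebra 𝔸]
    {j : BoundedLatticeHom (Fr (I × ℕ)) 𝔸} (hj : Function.Injective j)
    (hd : IsDense (Set.range j)) :
    IsCohenSystem fun (i : I) (s : List Bool) => j (stdTree i s) := by
  classical
  have hinf : ∀ (F : Finset I) (t : I → List Bool),
      F.inf (fun i => j (stdTree i (t i))) = j (F.inf fun i => stdTree i (t i)) := fun F t =>
    (map_finset_inf j F fun i => stdTree i (t i)).symm
  refine ⟨fun i b s => (hom_le hj).2 inf_le_right, fun i s => ?_, fun F t => ?_,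
    fun b hb => ?_⟩
  · rw [disjoint_hom hj]
    exact Disjoint.mono inf_le_left inf_le_left (disjoint_cyl_iff.2 (by simp))
  · rw [hinf, Ne, hom_eq_bot hj, ← Ne, fr_ne_bot_iff]
    choose y hy using fun i => exists_forall_mem_stdTree (I := I) (t i)
    exact ⟨fun p => y p.1 p.2, mem_finset_inf_stdTree.2 fun i _ => hy i i _ fun _ _ => rfl⟩
  · obtain ⟨f, hf, hfb⟩ := exists_hom_le hj hd hb
    obtain ⟨F, x, hF⟩ := exists_cyl_le hf
    choose t _ ht using fun i =>
      exists_stdTree_forall (I := I) (fun n => x (i, n)) (F.sup (fun p => p.2 + 1))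
    refine ⟨F.image Prod.fst, t, ?_⟩
    rw [hinf]
    refine ((hom_le hj).2 (le_trans ?_ hF)).trans hfb
    intro z hz p hp
    exact ht p.1 p.1 z (mem_finset_inf_stdTree.1 hz p.1 (Finset.mem_image_of_mem _ hp)) p.2
      (Finset.le_sup (f := fun p : I × ℕ => p.2 + 1) hp)

/-- A nonempty Cohen system in the completion exhibits `B` as a Cohen algebra. -/
theorem IsCohenSystem.isCohen {B 𝔸 : Type u} [BooleanAlgebra B] [CompleteBooleanAlgebra 𝔸]
    [Nonempty I] {u : I → List Bool → 𝔸} (hu : IsCohenSystem u) (e : Completion B ≃o 𝔸) :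
    IsCohen B := by
  obtain ⟨𝔹, _, j, hj, hd, ⟨e'⟩⟩ := exists_denseEmbedding (Fr (I × ℕ))
  obtain ⟨f⟩ := hu.nonempty_orderIso (isCohenSystem_stdTree hj hd)
  exact ⟨I × ℕ, inferInstance, ⟨(e.trans f).trans e'.symm⟩⟩

end StandardSystem

/-! ### Closed unbounded families -/

section Club

variable {B : Type u}

/-- A family of countable sets that is closed under unions of countable chains and cofinal among the
countable subsets of `T` contains sets `y ⊆ T` closed under any prescribed countably-valued
operation on finite subsets of `T`. -/
theorem exists_mem_closed_under {C : Set (Set B)} (hcount : ∀ y ∈ C, y.Countable)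
    (hclosed : ∀ D : Set (Set B), D ⊆ C → D.Nonempty → D.Countable →
      IsChain (fun x y => x ⊆ y) D → ⋃₀ D ∈ C) {T : Set B}
    (hT : ∀ x ⊆ T, x.Countable → ∃ y ∈ C, x ⊆ y ∧ y ⊆ T) (F : Finset B → Set B)
    (hF : ∀ s, (F s).Countable) (hFT : ∀ s : Finset B, (s : Set B) ⊆ T → F s ⊆ T) {x : Set B}
    (hxT : x ⊆ T) (hx : x.Countable) :
    ∃ y ∈ C, x ⊆ y ∧ y ⊆ T ∧ ∀ s : Finset B, (s : Set B) ⊆ y → F s ⊆ y := by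
  have hstep : ∀ y : {y // y ∈ C ∧ y ⊆ T}, ∃ z : {y // y ∈ C ∧ y ⊆ T}, y.1 ⊆ z.1 ∧
      ∀ s : Finset B, (s : Set B) ⊆ y → F s ⊆ z.1 := by
    rintro ⟨y, hy, hyT⟩
    have hc : {s : Finset B | (s : Set B) ⊆ y}.Countable := by
      have := (Set.countable_ofPred_finite_subset (hcount y hy)).preimage_of_injOn
        (f := fun s : Finset B => (s : Set B)) Finset.coe_injective.injOn
      exact this.mono fun s hs => (⟨s.finite_toSet, hs⟩ : (s : Set B).Finite ∧ (s : Set B) ⊆ y)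
    obtain ⟨z, hz, hyz, hzT⟩ := hT (y ∪ ⋃ s ∈ {s : Finset B | (s : Set B) ⊆ y}, F s)
      (Set.union_subset hyT (Set.iUnion₂_subset fun s hs => hFT s (hs.trans hyT)))
      ((hcount y hy).union (hc.biUnion fun s _ => hF s))
    refine ⟨⟨z, hz, hzT⟩, Set.subset_union_left.trans hyz, fun s hs => ?_⟩
    exact (Set.subset_biUnion_of_mem (u := F) (show s ∈ {s : Finset B | (s : Set B) ⊆ y} from
      hs)).trans (Set.subset_union_right.trans hyz)
  choose next hnext hnextF using hstep
  obtain ⟨y₀, hy₀, hxy₀, hy₀T⟩ := hT x hxT hx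
  set f : ℕ → {y // y ∈ C ∧ y ⊆ T} := fun n => next^[n] ⟨y₀, hy₀, hy₀T⟩ with hf
  have hfs : ∀ n, f (n + 1) = next (f n) := fun n => Function.iterate_succ_apply' _ _ _
  have hmono : Monotone fun n => (f n).1 := monotone_nat_of_le_succ fun n => by
    rw [hfs]
    exact hnext _
  refine ⟨⋃₀ (Set.range fun n => (f n).1), hclosed _ ?_ (Set.range_nonempty _)
    (Set.countable_range _) ?_, ?_, ?_, ?_⟩
  · rintro _ ⟨n, rfl⟩
    exact (f n).2.1
  · exact hmono.isChain_range
  · exact hxy₀.trans (Set.subset_sUnion_of_mem ⟨0, rfl⟩)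
  · refine Set.sUnion_subset ?_
    rintro _ ⟨n, rfl⟩
    exact (f n).2.2
  · intro s hs
    rw [Set.sUnion_range] at hs ⊢
    obtain ⟨n, hn⟩ := (hmono.directed_le).exists_mem_subset_of_finset_subset_biUnion hs
    refine (hnextF (f n) s hn).trans ?_
    rw [← hfs]
    exact Set.subset_iUnion (fun n => (f n).1) (n + 1)

variable [BooleanAlgebra B]

/-- A closed unbounded family of regular subalgebras of `B`, closed under the join of two
subalgebras. -/
structure IsRegularClub (C : Set (Set B)) : Prop extends IsClosedUnbounded C where
  regular : ∀ x ∈ C, ∃ A : BooleanSubalgebra B, (A : Set B) = x ∧ IsRegularSubalgebra A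
  join : ∀ A₁ ∈ C, ∀ A₂ ∈ C, (BooleanSubalgebra.closure (A₁ ∪ A₂) : Set B) ∈ C

/-- `D` is covered by `C` if it is the union of the members of `C` that it includes. -/
def IsCovered (C : Set (Set B)) (D : BooleanSubalgebra B) : Prop :=
  ∀ d ∈ D, ∃ y ∈ C, d ∈ y ∧ y ⊆ D

namespace IsRegularClub

variable {C : Set (Set B)}

/-- If `C` is cofinal among the countable subsets of `T` and `X` is predense in `T`, then a
countable part of `X` is predense in `B`: it is predense in a member of `C`, which is regular. -/
theorem exists_predense (hC : IsRegularClub C) {T : Set B}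
    (hT : ∀ x ⊆ T, x.Countable → ∃ y ∈ C, x ⊆ y ∧ y ⊆ T) {X : Set B} (hXT : X ⊆ T)
    (hX : ∀ a ∈ T, a ≠ ⊥ → ∃ x ∈ X, ¬Disjoint x a) :
    ∃ y : Set B, y.Countable ∧ ∀ b : B, b ≠ ⊥ → ∃ x ∈ X ∩ y, ¬Disjoint x b := by
  have hg : ∀ a : B, ∃ x, a ∈ T → a ≠ ⊥ → x ∈ X ∧ ¬Disjoint x a := by
    intro a
    by_cases h : a ∈ T ∧ a ≠ ⊥
    · obtain ⟨x, hx⟩ := hX a h.1 h.2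
      exact ⟨x, fun _ _ => hx⟩
    · exact ⟨⊥, fun h1 h2 => (h ⟨h1, h2⟩).elim⟩
  choose g hg using hg
  obtain ⟨y, hy, -, hyT, hyF⟩ := exists_mem_closed_under hC.countable hC.closed hT
    (fun s => g '' s ∩ X) (fun s => (s.countable_toSet.image g).mono Set.inter_subset_left)
    (fun s _ => Set.inter_subset_right.trans hXT) (Set.empty_subset T) Set.countable_empty
  obtain ⟨A, rfl, hA⟩ := hC.regular y hy
  refine ⟨A, hC.countable _ hy, isRegularSubalgebra_iff.1 hA _ Set.inter_subset_right ?_⟩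
  intro a ha ha0
  obtain ⟨h1, h2⟩ := hg a (hyT ha) ha0
  exact ⟨g a, ⟨h1, hyF {a} (by simpa using ha) ⟨⟨a, by simp, rfl⟩, h1⟩⟩, h2⟩

theorem countable_of_pairwiseDisjoint (hC : IsRegularClub C) {W : Set B}
    (hW : W.PairwiseDisjoint id) (hW0 : ∀ w ∈ W, w ≠ ⊥) : W.Countable := by
  -- `W` together with all elements disjoint from it is predense
  obtain ⟨y, hy, hyd⟩ := hC.exists_predense (T := Set.univ) (fun x _ hx => by
      obtain ⟨y, hy, hxy⟩ := hC.unbounded x hx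
      exact ⟨y, hy, hxy, Set.subset_univ y⟩)
    (X := W ∪ {b | ∀ w ∈ W, Disjoint w b}) (Set.subset_univ _) (by
      intro a _ ha
      by_cases h : ∀ w ∈ W, Disjoint w a
      · exact ⟨a, Or.inr h, by simpa using ha⟩
      · push Not at h
        obtain ⟨w, hw, hwa⟩ := h
        exact ⟨w, Or.inl hw, hwa⟩)
  refine hy.mono fun w hw => ?_
  obtain ⟨x, ⟨hx, hxy⟩, hxw⟩ := hyd w (hW0 w hw)
  rcases hx with hx | hx
  · rwa [← hW.elim hx hw hxw]
  · exact (hxw (hx w hw).symm).elim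

theorem isRegularSubalgebra_of_isCovered (hC : IsRegularClub C) {D : BooleanSubalgebra B}
    (hD : IsCovered C D) : IsRegularSubalgebra D := by
  have hfin : ∀ (f : ℕ → B), (∀ n, f n ∈ D) → ∃ y ∈ C, Set.range f ⊆ y ∧ y ⊆ D := by
    intro f hf
    choose z hz hfz hzD using fun n => hD (f n) (hf n)
    set w : ℕ → Set B := fun n => Nat.rec (z 0)
      (fun n y => (BooleanSubalgebra.closure (y ∪ z (n + 1)) : Set B)) n with hw
    have hws : ∀ n, w (n + 1) = (BooleanSubalgebra.closure (w n ∪ z (n + 1)) : Set B) :=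
      fun _ => rfl
    have hwC : ∀ n, w n ∈ C ∧ z n ⊆ w n ∧ w n ⊆ D := by
      intro n
      induction n with
      | zero => exact ⟨hz 0, subset_rfl, hzD 0⟩
      | succ n ih =>
        rw [hws]
        refine ⟨hC.join _ ih.1 _ (hz _),
          Set.subset_union_right.trans BooleanSubalgebra.subset_closure, ?_⟩
        exact BooleanSubalgebra.closure_le.2 (Set.union_subset ih.2.2 (hzD _))
    have hmono : Monotone w := monotone_nat_of_le_succ fun n => by
      rw [hws]
      exact Set.subset_union_left.trans BooleanSubalgebra.subset_closure
    refine ⟨⋃₀ (Set.range w), hC.closed _ ?_ (Set.range_nonempty _) (Set.countable_range _)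
      hmono.isChain_range, ?_, Set.sUnion_subset ?_⟩
    · rintro _ ⟨n, rfl⟩
      exact (hwC n).1
    · rintro _ ⟨n, rfl⟩
      exact ⟨w n, ⟨n, rfl⟩, (hwC n).2.1 (hfz n)⟩
    · rintro _ ⟨n, rfl⟩
      exact (hwC n).2.2
  refine isRegularSubalgebra_iff.2 fun X hX hXD b hb => ?_
  obtain ⟨y, -, hy⟩ := hC.exists_predense (T := D) (fun x hxD hx => by
    rcases x.eq_empty_or_nonempty with rfl | hne
    · obtain ⟨y, hy, -, h⟩ := hD ⊥ BooleanSubalgebra.bot_mem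
      exact ⟨y, hy, Set.empty_subset y, h⟩
    · obtain ⟨f, rfl⟩ := hx.exists_eq_range hne
      exact hfin f fun n => hxD ⟨n, rfl⟩) hX hXD
  obtain ⟨x, hx, hxb⟩ := hy b hb
  exact ⟨x, hx.1, hxb⟩

theorem isCovered_closure (hC : IsRegularClub C) {S : Set (Set B)} (hS : S ⊆ C)
    (hne : S.Nonempty) : IsCovered C (BooleanSubalgebra.closure (⋃₀ S)) := by
  intro d hd
  induction hd using BooleanSubalgebra.closure_bot_sup_induction with
  | mem x hx =>
    obtain ⟨y, hy, hxy⟩ := hx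
    exact ⟨y, hS hy, hxy, (Set.subset_sUnion_of_mem hy).trans BooleanSubalgebra.subset_closure⟩
  | bot =>
    obtain ⟨y, hy⟩ := hne
    obtain ⟨A, rfl, -⟩ := hC.regular y (hS hy)
    exact ⟨A, hS hy, A.bot_mem,
      (Set.subset_sUnion_of_mem hy).trans BooleanSubalgebra.subset_closure⟩
  | sup x _ y _ hx hy =>
    obtain ⟨z, hz, hxz, hzD⟩ := hx
    obtain ⟨w, hw, hyw, hwD⟩ := hy
    refine ⟨_, hC.join z hz w hw, BooleanSubalgebra.sup_mem
      (BooleanSubalgebra.subset_closure (Or.inl hxz))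
      (BooleanSubalgebra.subset_closure (Or.inr hyw)), ?_⟩
    exact BooleanSubalgebra.closure_le.2 (Set.union_subset hzD hwD)
  | compl x _ hx =>
    obtain ⟨z, hz, hxz, hzD⟩ := hx
    obtain ⟨A, rfl, -⟩ := hC.regular z hz
    exact ⟨A, hz, A.compl_mem hxz, hzD⟩

theorem isRegularSubalgebra_closure (hC : IsRegularClub C) {S : Set (Set B)} (hS : S ⊆ C) :
    IsRegularSubalgebra (BooleanSubalgebra.closure (⋃₀ S)) := by
  rcases S.eq_empty_or_nonempty with rfl | hne
  · have : BooleanSubalgebra.closure (⋃₀ (∅ : Set (Set B))) = ⊥ := by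
      rw [eq_bot_iff, BooleanSubalgebra.closure_le, Set.sUnion_empty]
      exact Set.empty_subset _
    rw [this]
    exact isRegularSubalgebra_bot
  · exact hC.isRegularSubalgebra_of_isCovered (hC.isCovered_closure hS hne)

end IsRegularClub

end Club

/-! ### Density -/

section Density

variable {B : Type u}

open Cardinal

theorem density_le [PartialOrder B] [OrderBot B] {D : Set B} (hD : IsDense D) :
    density B ≤ #D := csInf_le' ⟨D, hD, rfl⟩

variable (B) in
theorem exists_isDense_mk_eq [PartialOrder B] [OrderBot B] :
    ∃ D : Set B, IsDense D ∧ #D = density B :=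
  csInf_mem (s := {κ | ∃ D : Set B, IsDense D ∧ #D = κ})
    ⟨_, Set.univ, fun b hb => ⟨b, Set.mem_univ b, hb, le_rfl⟩, rfl⟩

variable [BooleanAlgebra B]

variable (B) in
theorem aleph0_le_density [Infinite B] : ℵ₀ ≤ density B := by
  obtain ⟨D, hD, hcard⟩ := exists_isDense_mk_eq B
  rw [← hcard]
  by_contra! h
  have hfin : Finite D := Cardinal.lt_aleph0_iff_finite.1 h
  -- an element is determined by the elements of `D` below it
  refine not_injective_infinite_finite (fun b : B => {d : D | d.1 ≤ b}) ?_
  have hle : ∀ a b : B, ({d : D | d.1 ≤ a} = {d : D | d.1 ≤ b}) → a ≤ b := by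
    intro a b hab
    by_contra hne
    obtain ⟨d, hd, hd0, hle⟩ := hD (a ⊓ bᶜ) (fun h => hne (by
      rwa [← disjoint_iff, disjoint_compl_right_iff] at h))
    have h1 : (⟨d, hd⟩ : D) ∈ {d : D | d.1 ≤ a} := hle.trans inf_le_left
    rw [hab] at h1
    exact hd0 (disjoint_self.1 (disjoint_compl_right.mono h1 (hle.trans inf_le_right)))
  exact fun a b hab => le_antisymm (hle a b hab) (hle b a hab.symm)

theorem HasUniformDensity.exists_forall_not_le (hB : HasUniformDensity B) {D : Set B}
    (hD : #D < density B) {b : B} (hb : b ≠ ⊥) :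
    ∃ e, e ≠ ⊥ ∧ e ≤ b ∧ ∀ d ∈ D, d ≤ e → d = ⊥ := by
  have hlt : #((↑) ⁻¹' D : Set (Set.Iic b)) < density (Set.Iic b) := by
    rw [hB b hb]
    exact (Cardinal.mk_preimage_of_injective _ _ Subtype.val_injective).trans_lt hD
  have hnd : ¬IsDense ((↑) ⁻¹' D : Set (Set.Iic b)) := fun h => (density_le h).not_gt hlt
  unfold IsDense at hnd
  push Not at hnd
  obtain ⟨e, he, h⟩ := hnd
  refine ⟨e, fun h0 => he (Subtype.ext h0), e.2, fun d hd hde => ?_⟩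
  by_contra hd0
  exact h ⟨d, hde.trans e.2⟩ hd (fun h0 => hd0 (congrArg Subtype.val h0)) hde

theorem mk_closure_le (s : Set B) : #(BooleanSubalgebra.closure s) ≤ max ℵ₀ #s := by
  let T : ℕ → Set B := fun n => Nat.rec (insert ⊥ s)
    (fun _ t => t ∪ (compl '' t ∪ Set.image2 (· ⊔ ·) t t)) n
  have hT : ∀ n, #(↥(T n)) ≤ max ℵ₀ #s := by
    intro n
    induction n with
    | zero =>
      refine (Cardinal.mk_insert_le).trans ?_
      exact Cardinal.add_le_of_le (le_max_left _ _) (le_max_right _ _)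
        (Cardinal.one_lt_aleph0.le.trans (le_max_left _ _))
    | succ n ih =>
      have h0 : ℵ₀ ≤ max ℵ₀ #s := le_max_left _ _
      refine (Cardinal.mk_union_le _ _).trans (Cardinal.add_le_of_le h0 ih ?_)
      refine (Cardinal.mk_union_le _ _).trans (Cardinal.add_le_of_le h0 ?_ ?_)
      · exact Cardinal.mk_image_le.trans ih
      · rw [← Set.image_uncurry_prod]
        refine Cardinal.mk_image_le.trans ?_
        rw [Cardinal.mk_setProd]
        exact Cardinal.mul_le_of_le h0 ih ih
  have hmono : Monotone T := monotone_nat_of_le_succ fun n => Set.subset_union_left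
  have hsub : (BooleanSubalgebra.closure s : Set B) ⊆ ⋃ n, T n := by
    intro x hx
    induction hx using BooleanSubalgebra.closure_bot_sup_induction with
    | mem x hx => exact Set.mem_iUnion.2 ⟨0, Or.inr hx⟩
    | bot => exact Set.mem_iUnion.2 ⟨0, Or.inl rfl⟩
    | sup x _ y _ hx hy =>
      obtain ⟨m, hm⟩ := Set.mem_iUnion.1 hx
      obtain ⟨n, hn⟩ := Set.mem_iUnion.1 hy
      exact Set.mem_iUnion.2 ⟨max m n + 1, Or.inr (Or.inr ⟨x, hmono (le_max_left m n) hm, y,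
        hmono (le_max_right m n) hn, rfl⟩)⟩
    | compl x _ hx =>
      obtain ⟨n, hn⟩ := Set.mem_iUnion.1 hx
      exact Set.mem_iUnion.2 ⟨n + 1, Or.inr (Or.inl ⟨x, hn, rfl⟩)⟩
  refine (Cardinal.mk_le_mk_of_subset hsub).trans ?_
  have h1 : #(↥(⋃ n, T n)) ≤ ℵ₀ * ⨆ n, #(↥(T n)) := by
    have := Cardinal.mk_iUnion_le_lift T
    simpa using this
  exact h1.trans (Cardinal.mul_le_of_le (le_max_left _ _) (le_max_left _ _) (ciSup_le' hT))

theorem countable_closure {s : Set B} (hs : s.Countable) :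
    (BooleanSubalgebra.closure s : Set B).Countable :=
  Cardinal.le_aleph0_iff_set_countable.1 ((mk_closure_le s).trans
    (max_le le_rfl (Cardinal.le_aleph0_iff_set_countable.2 hs)))

end Density

/-! ### From a regular club to a Cohen system -/

section Construction

variable {B : Type u} [BooleanAlgebra B]

open Cardinal

/-- In the subalgebra generated by two subalgebras `D` and `A`, the elements `d ⊓ a` are dense. -/
theorem exists_inf_le_of_mem_closure {D A : BooleanSubalgebra B} {e : B}
    (he : e ∈ BooleanSubalgebra.closure ((D : Set B) ∪ A)) (he0 : e ≠ ⊥) :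
    ∃ d ∈ D, ∃ a ∈ A, ¬Disjoint d a ∧ d ⊓ a ≤ e := by
  have key : ∀ b : B, b ≠ ⊥ → ∃ d ∈ D, ∃ a ∈ A, ¬Disjoint b (d ⊓ a) ∧
      (d ⊓ a ≤ e ∨ d ⊓ a ≤ eᶜ) := by
    clear he0
    induction he using BooleanSubalgebra.closure_bot_sup_induction with
    | mem x hx =>
      intro b hb
      have h : ¬Disjoint b x ∨ ¬Disjoint b xᶜ := by
        by_contra! h
        exact hb (disjoint_self.1 (h.1.mono_right (h.2.le_compl_right.trans (compl_compl x).le)))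
      rcases hx with hx | hx
      · rcases h with h | h
        · exact ⟨x, hx, ⊤, A.top_mem, by simpa using h, by simp⟩
        · exact ⟨xᶜ, D.compl_mem hx, ⊤, A.top_mem, by simpa using h, by simp⟩
      · rcases h with h | h
        · exact ⟨⊤, D.top_mem, x, hx, by simpa using h, by simp⟩
        · exact ⟨⊤, D.top_mem, xᶜ, A.compl_mem hx, by simpa using h, by simp⟩
    | bot => exact fun b hb => ⟨⊤, D.top_mem, ⊤, A.top_mem, by simpa using hb, by simp⟩
    | sup x _ y _ hx hy =>
      intro b hb
      obtain ⟨d, hd, a, ha, h1, h2⟩ := hx b hb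
      rcases h2 with h2 | h2
      · exact ⟨d, hd, a, ha, h1, Or.inl (le_sup_of_le_left h2)⟩
      · obtain ⟨d', hd', a', ha', h1', h2'⟩ := hy _ (mt disjoint_iff.2 h1)
        refine ⟨d ⊓ d', D.inf_mem hd hd', a ⊓ a', A.inf_mem ha ha', ?_, ?_⟩
        · rwa [inf_inf_inf_comm, ← disjoint_assoc]
        · rw [inf_inf_inf_comm, compl_sup]
          rcases h2' with h2' | h2'
          · exact Or.inl (le_sup_of_le_right (inf_le_right.trans h2'))
          · exact Or.inr (inf_le_inf h2 h2')
    | compl x _ hx =>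
      intro b hb
      obtain ⟨d, hd, a, ha, h1, h2⟩ := hx b hb
      exact ⟨d, hd, a, ha, h1, by rw [compl_compl]; exact h2.symm⟩
  obtain ⟨d, hd, a, ha, h1, h2⟩ := key e he0
  refine ⟨d, hd, a, ha, fun h => h1 (by rw [h.eq_bot]; exact disjoint_bot_right), ?_⟩
  rcases h2 with h2 | h2
  · exact h2
  · exact (h1 (disjoint_compl_right.mono_right h2)).elim

/-- The property of a countable `y` that makes `closure (D ∪ y)` nowhere trivial over `D`: the
`e ∈ y` below a given `a ∈ y` that include no nonzero trace `d ⊓ a`, `d ∈ D`, have a join that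
covers `a` as far as `D` can see. -/
def SplitsOver (D y : Set B) : Prop :=
  ∀ a ∈ y, ∀ d ∈ D, ¬Disjoint d a → ∃ e ∈ y, e ≤ a ∧ ¬Disjoint d e ∧
    ∀ d' ∈ D, d' ⊓ a ≤ e → d' ⊓ a = ⊥

/-- Over a subalgebra `D` that is smaller than the density of `B`, every countable set extends to a
member of the club that splits over `D`. The countable chain condition allows the splitting elements
below each `a` to be chosen from a countable set, a maximal antichain. -/
theorem IsRegularClub.exists_splitsOver {C : Set (Set B)} (hC : IsRegularClub C)
    (hB : HasUniformDensity B) {D : BooleanSubalgebra B} (hD : #D < density B) {x : Set B}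
    (hx : x.Countable) : ∃ y ∈ C, x ⊆ y ∧ SplitsOver (D : Set B) y := by
  have hW : ∀ a : B, ∃ W : Set B, W.Countable ∧ (∀ e ∈ W, e ≤ a ∧
      ∀ d' ∈ D, d' ⊓ a ≤ e → d' ⊓ a = ⊥) ∧ ∀ d ∈ D, ¬Disjoint d a → ∃ e ∈ W, ¬Disjoint d e := by
    intro a
    obtain ⟨W, hWP, hWd, hWm⟩ := exists_pairwiseDisjoint_predense
      {e | e ≠ ⊥ ∧ e ≤ a ∧ ∀ d' ∈ D, d' ⊓ a ≤ e → d' ⊓ a = ⊥} fun e he => he.1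
    refine ⟨W, hC.countable_of_pairwiseDisjoint hWd fun w hw => (hWP hw).1,
      fun e he => (hWP he).2, fun d hd hda => ?_⟩
    have hcard : #((fun d' => d' ⊓ (d ⊓ a)) '' (D : Set B)) < density B :=
      Cardinal.mk_image_le.trans_lt hD
    obtain ⟨e, he0, hle, he⟩ := hB.exists_forall_not_le hcard (mt disjoint_iff.2 hda)
    have hmem : e ≠ ⊥ ∧ e ≤ a ∧ ∀ d' ∈ D, d' ⊓ a ≤ e → d' ⊓ a = ⊥ := by
      refine ⟨he0, hle.trans inf_le_right, fun d' hd' h => ?_⟩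
      have h1 : d' ⊓ a = d' ⊓ (d ⊓ a) :=
        le_antisymm (le_inf inf_le_left (h.trans hle)) (inf_le_inf_left _ inf_le_right)
      rw [h1] at h ⊢
      exact he _ ⟨d', hd', rfl⟩ h
    obtain ⟨w, hw, hwe⟩ := hWm e hmem
    exact ⟨w, hw, fun h => hwe (h.symm.mono_right (hle.trans inf_le_left))⟩
  choose W hWc hWle hWm using hW
  obtain ⟨y, hy, hxy, -, hyF⟩ := exists_mem_closed_under hC.countable hC.closed (T := Set.univ)
    (fun x _ hx => by
      obtain ⟨y, hy, hxy⟩ := hC.unbounded x hx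
      exact ⟨y, hy, hxy, Set.subset_univ y⟩)
    (fun s => ⋃ a ∈ s, W a) (fun s => s.countable_toSet.biUnion fun a _ => hWc a)
    (fun _ _ => Set.subset_univ _) (Set.subset_univ x) hx
  refine ⟨y, hy, hxy, fun a ha d hd hda => ?_⟩
  obtain ⟨e, he, hde⟩ := hWm a d hd hda
  exact ⟨e, hyF {a} (by simpa using ha) (by simpa using he), (hWle a e he).1, hde,
    (hWle a e he).2⟩

/-- One step of the chain: adjoining to `D` a member of the club that splits over `D` adjoins a
Cohen real, in the form of a binary tree in the completion. -/
theorem exists_tree_of_splitsOver {𝔹 : Type u} [CompleteBooleanAlgebra 𝔹]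
    {j : BoundedLatticeHom B 𝔹} (hj : Function.Injective j) (hd : IsDense (Set.range j))
    {D A E : BooleanSubalgebra B} (hD : IsRegularSubalgebra D) (hE : IsRegularSubalgebra E)
    (hDE : D ≤ E) (hAE : A ≤ E) (hEDA : (E : Set B) ⊆ BooleanSubalgebra.closure ((D : Set B) ∪ A))
    (hA : (A : Set B).Countable) (hs : SplitsOver (D : Set B) A) :
    ∃ u : List Bool → 𝔹, (∀ b s, u (b :: s) ≤ u s) ∧
      (∀ s, Disjoint (u (true :: s)) (u (false :: s))) ∧
      (∀ s, ∀ d ∈ D.map j, d ≠ ⊥ → ∃ e ∈ E.map j, e ≠ ⊥ ∧ e ≤ d ⊓ u s) ∧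
      (∀ e ∈ E.map j, e ≠ ⊥ → ∃ d ∈ D.map j, d ≠ ⊥ ∧ ∃ s, d ⊓ u s ≤ e) := by
  obtain ⟨a, ha⟩ := hA.exists_eq_range ⟨⊥, A.bot_mem⟩
  have haA : ∀ n, a n ∈ A := fun n => by
    rw [← SetLike.mem_coe, ha]
    exact ⟨n, rfl⟩
  refine exists_tree (hD.map j hj hd) (hE.map j hj hd) (BooleanSubalgebra.map_mono hDE) ?_
    (fun n => j (a n)) (fun n => ⟨a n, hAE (haA n), rfl⟩) ?_
  · rintro _ ⟨b, hb, rfl⟩ hb0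
    obtain ⟨d, hd, a, ha, hda, hle⟩ := exists_inf_le_of_mem_closure (hEDA hb)
      (mt (hom_eq_bot hj).2 hb0)
    obtain ⟨e, he, hea, hde, h⟩ := hs a ha d hd hda
    refine ⟨j (d ⊓ e), ⟨_, E.inf_mem (hDE hd) (hAE he), rfl⟩, ?_, ?_, ?_⟩
    · rwa [Ne, hom_eq_bot hj, ← disjoint_iff]
    · exact (hom_le hj).2 ((inf_le_inf_left _ hea).trans hle)
    · rintro _ ⟨d', hd', rfl⟩ h'
      rw [← map_inf, hom_le hj] at h'
      rw [← map_inf, hom_eq_bot hj]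
      have h1 : d' ⊓ d ⊓ a = ⊥ := h _ (D.inf_mem hd' hd) (by
        rw [inf_assoc]
        exact (inf_le_inf_left _ hle).trans (h'.trans inf_le_right))
      rw [eq_bot_iff, ← h1]
      exact le_inf (le_inf inf_le_left (h'.trans inf_le_left))
        (h'.trans (inf_le_right.trans hea))
  · rintro _ ⟨e, he, rfl⟩ he0
    obtain ⟨d, hd, x, hx, hdx, hle⟩ := exists_inf_le_of_mem_closure (hEDA he)
      (mt (hom_eq_bot hj).2 he0)
    rw [← SetLike.mem_coe, ha] at hx
    obtain ⟨n, rfl⟩ := hx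
    exact ⟨j d, ⟨d, hd, rfl⟩, n, by rwa [disjoint_hom hj], by
      rwa [← map_inf, hom_le hj]⟩

/-- The transfinite construction, along a well-order `I` whose proper initial segments generate
subalgebras smaller than the density of `B`. -/
theorem IsRegularClub.isCohen_of_wellOrder [Nontrivial B] {C : Set (Set B)}
    (hC : IsRegularClub C) (hB : HasUniformDensity B) {I : Type u} [Nonempty I] [LinearOrder I]
    [WellFoundedLT I] (x : I → B → Prop) (hx : ∀ i, {b | x i b}.Countable)
    (hxd : IsDense {b | ∃ i, x i b})
    (hcard : ∀ (i : I) (A : I → Set B), (∀ j < i, (A j).Countable) →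
      #(BooleanSubalgebra.closure (⋃₀ (A '' Set.Iio i))) < density B) : IsCohen B := by
  classical
  obtain ⟨A, hA⟩ : ∃ A : I → Set B, ∀ i, A i ∈ C ∧ {b | x i b} ⊆ A i ∧
      SplitsOver (BooleanSubalgebra.closure (⋃₀ (A '' Set.Iio i)) : Set B) (A i) := by
    let R : I → Set (Set B) → Set B → Prop := fun i S y => y ∈ C ∧ {b | x i b} ⊆ y ∧
      SplitsOver (BooleanSubalgebra.closure (⋃₀ S) : Set B) y
    let G : (i : I) → ((k : I) → k < i → Set B) → Set B := fun i A =>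
      Classical.epsilon (R i {y | ∃ k, ∃ h : k < i, A k h = y})
    let A : I → Set B := wellFounded_lt.fix G
    have hA : ∀ i, A i = Classical.epsilon (R i (A '' Set.Iio i)) := by
      intro i
      have h1 : A i = G i fun k _ => A k := wellFounded_lt.fix_eq G i
      have h2 : {y | ∃ k, ∃ _ : k < i, A k = y} = A '' Set.Iio i := by
        ext y
        simp
      rw [h1, ← h2]
    refine ⟨A, fun i => ?_⟩
    induction i using WellFoundedLT.induction with
    | ind i ih =>
      obtain ⟨y, hy⟩ := hC.exists_splitsOver hB
        (hcard i A fun k hk => hC.countable _ (ih k hk).1) (hx i)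
      have := Classical.epsilon_spec (p := R i (A '' Set.Iio i)) ⟨y, hy⟩
      rw [← hA i] at this
      exact this
  obtain ⟨𝔹, _, j, hj, hd, ⟨iso⟩⟩ := exists_denseEmbedding B
  have hreg : ∀ s : Set I, IsRegularSubalgebra (BooleanSubalgebra.closure (⋃₀ (A '' s))) :=
    fun s => hC.isRegularSubalgebra_closure (by
      rintro _ ⟨i, -, rfl⟩
      exact (hA i).1)
  have hmap : ∀ s : Set I, (BooleanSubalgebra.closure (⋃₀ (A '' s))).map j =
      BooleanSubalgebra.closure (⋃ i ∈ s, j '' A i) := by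
    intro s
    refine le_antisymm ?_ ?_
    · rw [BooleanSubalgebra.map_le_iff_le_comap, BooleanSubalgebra.closure_le]
      rintro b ⟨_, ⟨i, hi, rfl⟩, hb⟩
      exact BooleanSubalgebra.subset_closure (Set.mem_iUnion₂.2 ⟨i, hi, b, hb, rfl⟩)
    · rw [BooleanSubalgebra.closure_le]
      refine Set.iUnion₂_subset fun i hi => ?_
      rintro _ ⟨b, hb, rfl⟩
      exact ⟨b, BooleanSubalgebra.subset_closure ⟨A i, ⟨i, hi, rfl⟩, hb⟩, rfl⟩
  have htree : ∀ i, ∃ u : List Bool → 𝔹, (∀ b s, u (b :: s) ≤ u s) ∧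
      (∀ s, Disjoint (u (true :: s)) (u (false :: s))) ∧
      (∀ s, ∀ d ∈ BooleanSubalgebra.closure (⋃ k ∈ Set.Iio i, j '' A k), d ≠ ⊥ →
        ∃ e ∈ BooleanSubalgebra.closure (⋃ k ∈ Set.Iic i, j '' A k), e ≠ ⊥ ∧ e ≤ d ⊓ u s) ∧
      (∀ e ∈ BooleanSubalgebra.closure (⋃ k ∈ Set.Iic i, j '' A k), e ≠ ⊥ →
        ∃ d ∈ BooleanSubalgebra.closure (⋃ k ∈ Set.Iio i, j '' A k), d ≠ ⊥ ∧
          ∃ s, d ⊓ u s ≤ e) := by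
    intro i
    obtain ⟨hAi, -, hsplit⟩ := hA i
    obtain ⟨A', hA', -⟩ := hC.regular _ hAi
    rw [← hmap, ← hmap]
    refine exists_tree_of_splitsOver hj hd (A := A') (hreg _) (hreg _) ?_ ?_ ?_ ?_ ?_
    · exact BooleanSubalgebra.closure_mono (Set.sUnion_mono (Set.image_mono
        fun k hk => le_of_lt hk))
    · intro b hb
      refine BooleanSubalgebra.subset_closure ⟨A i, ⟨i, Set.mem_Iic.2 le_rfl, rfl⟩, ?_⟩
      rwa [← hA']
    · refine BooleanSubalgebra.closure_le.2 ?_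
      rintro b ⟨_, ⟨k, hk, rfl⟩, hb⟩
      refine BooleanSubalgebra.subset_closure ?_
      rcases (Set.mem_Iic.1 hk).lt_or_eq with h | rfl
      · exact Or.inl (BooleanSubalgebra.subset_closure ⟨A k, ⟨k, h, rfl⟩, hb⟩)
      · rw [← hA'] at hb
        exact Or.inr hb
    · rw [hA']
      exact hC.countable _ hAi
    · rwa [hA']
  choose u h1 h2 h3 h4 using htree
  have : Nontrivial 𝔹 := hj.nontrivial
  refine (isCohenSystem_of_chain (fun i => j '' A i) u h1 h2 h3 h4 fun b hb => ?_).isCohen iso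
  obtain ⟨c, hc, hcb⟩ := exists_hom_le hj hd hb
  obtain ⟨e, ⟨i, hi⟩, he0, hec⟩ := hxd c hc
  exact ⟨i, j e, ⟨e, (hA i).2.1 hi, rfl⟩, mt (hom_eq_bot hj).1 he0,
    ((hom_le hj).2 hec).trans hcb⟩

theorem IsRegularClub.isCohen [Infinite B] {C : Set (Set B)} (hC : IsRegularClub C)
    (hB : HasUniformDensity B) : IsCohen B := by
  obtain ⟨S, hS, hcard⟩ := exists_isDense_mk_eq B
  rcases (aleph0_le_density B).eq_or_lt with h0 | h0
  · -- countable density: a single step over the trivial subalgebra suffices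
    refine hC.isCohen_of_wellOrder hB (I := PUnit) (fun _ b => b ∈ S) (fun _ => ?_) ?_ ?_
    · rw [← h0] at hcard
      exact Cardinal.le_aleph0_iff_set_countable.1 hcard.le
    · intro b hb
      obtain ⟨d, hd, h⟩ := hS b hb
      exact ⟨d, ⟨PUnit.unit, hd⟩, h⟩
    · intro i A _
      have h1 : BooleanSubalgebra.closure (⋃₀ (A '' Set.Iio i)) ≤ ⊥ := by
        rw [BooleanSubalgebra.closure_le]
        rintro b ⟨_, ⟨k, hk, -⟩, -⟩
        exact (lt_irrefl k (show k < k from hk)).elim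
      refine lt_of_lt_of_le ?_ h0.le
      exact Cardinal.lt_aleph0_iff_set_finite.2 ((Set.toFinite ({⊥, ⊤} : Set B)).subset h1)
  · -- otherwise a dense set is enumerated in order type the initial ordinal of the density
    have e : (density B).ord.ToType ≃ S := Classical.choice (Cardinal.eq.1 (by
      rw [Cardinal.mk_toType, Cardinal.card_ord, hcard]))
    have hne : Nonempty (density B).ord.ToType := by
      rw [← Cardinal.mk_ne_zero_iff, Cardinal.mk_toType, Cardinal.card_ord]
      exact (Cardinal.aleph0_pos.trans h0).ne'
    refine hC.isCohen_of_wellOrder hB (I := (density B).ord.ToType) (fun i b => b = e i)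
      (fun i => by simp) ?_ ?_
    · intro b hb
      obtain ⟨d, hd, h⟩ := hS b hb
      exact ⟨d, ⟨e.symm ⟨d, hd⟩, by simp⟩, h⟩
    · intro i A hA
      refine (mk_closure_le _).trans_lt (max_lt h0 ?_)
      have h1 : #(Set.Iio i) < density B := by
        have h := Cardinal.mk_Iio_lt i
          (by rw [Cardinal.mk_toType, Cardinal.card_ord, Ordinal.type_toType])
        rwa [Cardinal.mk_toType, Cardinal.card_ord] at h
      rw [Set.sUnion_image, Set.biUnion_eq_iUnion]
      refine (Cardinal.mk_iUnion_le _).trans_lt (Cardinal.mul_lt_of_lt h0.le h1 ?_)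
      exact (ciSup_le' fun k : Set.Iio i =>
        Cardinal.le_aleph0_iff_set_countable.2 (hA k k.2)).trans_lt h0

end Construction

/-! ### Supports and the club of a Cohen algebra -/

section Support

variable {X 𝔸 B : Type u} [BooleanAlgebra 𝔸] [BooleanAlgebra B]

theorem exists_cyl_hom_le {k : BoundedLatticeHom (Fr X) 𝔸} (hk : Function.Injective k)
    (hkd : IsDense (Set.range k)) {x : 𝔸} (hx : x ≠ ⊥) : ∃ F y, k (cyl F y) ≤ x := by
  obtain ⟨f, hf, hfx⟩ := exists_hom_le hk hkd hx
  obtain ⟨F, y, h⟩ := exists_cyl_le hf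
  exact ⟨F, y, ((hom_le hk).2 h).trans hfx⟩

open MeasureTheory in
/-- The countable chain condition for `Fr X`: pairwise disjoint cylinders have positive measure in
the product of fair coins. -/
theorem countable_of_pairwise_disjoint_cyl {ι : Type u} (F : ι → Finset X) (y : ι → X → Bool)
    (h : Pairwise fun i j => Disjoint (cyl (F i) (y i)) (cyl (F j) (y j))) : Countable ι := by
  classical
  let μ : Measure (X → Bool) :=
    Measure.infinitePi fun _ => (PMF.uniformOfFintype Bool).toMeasure
  have hpi : ∀ i, (cyl (F i) (y i) : Set (X → Bool)) = Set.pi (F i) fun a => {y i a} := by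
    intro i
    ext z
    exact mem_cyl.trans (by simp)
  have hpos : ∀ i, 0 < μ (cyl (F i) (y i) : Set (X → Bool)) := by
    intro i
    rw [hpi, Measure.infinitePi_pi _ fun a _ => measurableSet_singleton _, pos_iff_ne_zero,
      Finset.prod_ne_zero_iff]
    intro a _
    rw [PMF.toMeasure_apply_singleton _ _ (measurableSet_singleton _)]
    simp
  have hmeas : ∀ i, MeasurableSet (cyl (F i) (y i) : Set (X → Bool)) := by
    intro i
    rw [hpi]
    exact MeasurableSet.pi (F i).countable_toSet fun a _ => measurableSet_singleton _
  have hc := Measure.countable_meas_pos_of_disjoint_iUnion (μ := μ) hmeas (by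
    intro i i' hii'
    obtain ⟨a, h1, h2, h3⟩ := disjoint_cyl_iff.1 (h hii')
    refine Set.disjoint_left.2 fun z hz hz' => h3 ?_
    rw [← hz a h1, hz' a h2])
  rw [← Set.countable_univ_iff]
  exact hc.mono fun i _ => hpos i

theorem countable_of_pairwiseDisjoint_of_cohen {k : BoundedLatticeHom (Fr X) 𝔸}
    (hk : Function.Injective k) (hkd : IsDense (Set.range k)) {W : Set 𝔸}
    (hW : W.PairwiseDisjoint id) (hW0 : ∀ w ∈ W, w ≠ ⊥) : W.Countable := by
  choose F y hF using fun w : W => exists_cyl_hom_le hk hkd (hW0 w w.2)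
  refine countable_of_pairwise_disjoint_cyl F y fun w w' hww' => ?_
  refine (disjoint_hom hk).1 ?_
  exact (hW w.2 w'.2 (fun h => hww' (Subtype.ext h))).mono (hF w) (hF w')

/-- `x` is supported by the set `S` of coordinates: every cylinder below `x` remains below `x` after
the coordinates outside `S` have been released. -/
def IsSupported (k : BoundedLatticeHom (Fr X) 𝔸) (S : Set X) (x : 𝔸) : Prop :=
  ∀ (F : Finset X) (y : X → Bool), k (cyl F y) ≤ x →
    ∃ G ⊆ F, (G : Set X) ⊆ S ∧ k (cyl G y) ≤ x

section

variable {k : BoundedLatticeHom (Fr X) 𝔸} {S S' : Set X} {x x' : 𝔸}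

theorem cyl_anti {F G : Finset X} (h : G ⊆ F) (y : X → Bool) : cyl F y ≤ cyl G y :=
  cyl_le_cyl_iff.2 ⟨h, fun _ _ => rfl⟩

theorem IsSupported.mono (h : IsSupported k S x) (hS : S ⊆ S') : IsSupported k S' x := by
  intro F y hF
  obtain ⟨G, hG, hGS, hGx⟩ := h F y hF
  exact ⟨G, hG, hGS.trans hS, hGx⟩

theorem IsSupported.inf (hk : Function.Injective k) (h : IsSupported k S x)
    (h' : IsSupported k S x') : IsSupported k S (x ⊓ x') := by
  classical
  intro F y hF
  obtain ⟨G, hG, hGS, hGx⟩ := h F y (hF.trans inf_le_left)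
  obtain ⟨G', hG', hGS', hGx'⟩ := h' F y (hF.trans inf_le_right)
  refine ⟨G ∪ G', Finset.union_subset hG hG', by simp [hGS, hGS'], le_inf ?_ ?_⟩
  · exact ((hom_le hk).2 (cyl_anti Finset.subset_union_left y)).trans hGx
  · exact ((hom_le hk).2 (cyl_anti Finset.subset_union_right y)).trans hGx'

theorem IsSupported.compl (hk : Function.Injective k) (hkd : IsDense (Set.range k))
    (h : IsSupported k S x) : IsSupported k S xᶜ := by
  classical
  intro F y hF
  refine ⟨F.filter (· ∈ S), Finset.filter_subset _ _, fun i hi => (Finset.mem_filter.1 hi).2, ?_⟩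
  by_contra hne
  obtain ⟨H, z, hH⟩ := exists_cyl_hom_le hk hkd (x := k (cyl (F.filter (· ∈ S)) y) ⊓ x)
    (fun h0 => hne (le_compl_iff_disjoint_right.2 (disjoint_iff.2 h0)))
  obtain ⟨H', hH', hHS, hHx⟩ := h H z (hH.trans inf_le_right)
  -- the two cylinders agree on `S`, so they are compatible
  have hdis : Disjoint (cyl H' z) (cyl F y) :=
    (disjoint_hom hk).1 (disjoint_compl_right.mono hHx hF)
  obtain ⟨i, hi, hiF, hne'⟩ := disjoint_cyl_iff.1 hdis
  have hle := (cyl_le_cyl_iff.1 ((hom_le hk).1 (hH.trans inf_le_left))).2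
  exact hne' (hle i (Finset.mem_filter.2 ⟨hiF, hHS hi⟩))

/-- The elements supported by `S` form a subalgebra. -/
def supportedSubalgebra (hk : Function.Injective k) (hkd : IsDense (Set.range k)) (S : Set X) :
    BooleanSubalgebra 𝔸 where
  carrier := {x | IsSupported k S x}
  bot_mem' := fun F y hF => (cyl_ne_bot F y ((hom_eq_bot hk).1 (le_bot_iff.1 hF))).elim
  infClosed' := fun _ h _ h' => IsSupported.inf hk h h'
  compl_mem' := fun h => IsSupported.compl hk hkd h
  supClosed' := fun x h x' h' => by
    have h1 := ((IsSupported.compl hk hkd h).inf hk (IsSupported.compl hk hkd h')).compl hk hkd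
    rwa [compl_inf, compl_compl, compl_compl] at h1

theorem exists_countable_isSupported (hk : Function.Injective k) (hkd : IsDense (Set.range k))
    (x : 𝔸) : ∃ S : Set X, S.Countable ∧ IsSupported k S x := by
  classical
  -- the coordinates of a maximal antichain of cylinders below `x` or below `xᶜ`
  obtain ⟨W, hWP, hWd, hWm⟩ := exists_pairwiseDisjoint_predense
    {p : 𝔸 | ∃ F y, k (cyl F y) = p ∧ (p ≤ x ∨ p ≤ xᶜ)} (by
      rintro _ ⟨F, y, rfl, -⟩
      exact mt (hom_eq_bot hk).1 (cyl_ne_bot F y))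
  have hW0 : ∀ w ∈ W, w ≠ ⊥ := by
    intro w hw
    obtain ⟨F, y, rfl, -⟩ := hWP hw
    exact mt (hom_eq_bot hk).1 (cyl_ne_bot F y)
  have hWc := countable_of_pairwiseDisjoint_of_cohen hk hkd hWd hW0
  have : Countable W := hWc
  choose P Q hPQ hx using fun w : W => hWP w.2
  refine ⟨⋃ w : W, (P w : Set X), Set.countable_iUnion fun w => (P w).countable_toSet, ?_⟩
  intro F y hF
  refine ⟨F.filter (· ∈ ⋃ w : W, (P w : Set X)), Finset.filter_subset _ _,
    fun i hi => (Finset.mem_filter.1 hi).2, ?_⟩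
  by_contra hne
  obtain ⟨H, z, hH⟩ := exists_cyl_hom_le hk hkd
    (x := k (cyl (F.filter (· ∈ ⋃ w : W, (P w : Set X))) y) ⊓ xᶜ)
    (fun h0 => hne (disjoint_compl_right_iff.1 (disjoint_iff.2 h0)))
  obtain ⟨w, hw, hwH⟩ := hWm (k (cyl H z)) ⟨H, z, rfl, Or.inr (hH.trans inf_le_right)⟩
  rcases hx ⟨w, hw⟩ with h | h
  · exact hwH (disjoint_compl_right.mono h (hH.trans inf_le_right))
  · have h1 : Disjoint (cyl (P ⟨w, hw⟩) (Q ⟨w, hw⟩)) (cyl F y) := by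
      rw [← disjoint_hom hk, hPQ]
      exact disjoint_compl_left.mono h hF
    obtain ⟨i, hiP, hiF, hne'⟩ := disjoint_cyl_iff.1 h1
    obtain ⟨h2, h3⟩ := cyl_le_cyl_iff.1 ((hom_le hk).1 (hH.trans inf_le_left))
    have hiG : i ∈ F.filter (· ∈ ⋃ w : W, (P w : Set X)) :=
      Finset.mem_filter.2 ⟨hiF, Set.mem_iUnion.2 ⟨⟨w, hw⟩, hiP⟩⟩
    rw [show w = k (cyl (P ⟨w, hw⟩) (Q ⟨w, hw⟩)) from (hPQ ⟨w, hw⟩).symm, disjoint_hom hk] at hwH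
    exact hwH (disjoint_cyl_iff.2 ⟨i, hiP, h2 hiG, by rwa [h3 i hiG]⟩)

end

/-- `A` is adapted to the set `S` of coordinates: it is a dense subalgebra of the algebra of all
elements supported by `S`. -/
structure IsAdapted (j : BoundedLatticeHom B 𝔸) (k : BoundedLatticeHom (Fr X) 𝔸)
    (A : BooleanSubalgebra B) (S : Set X) : Prop where
  supported : ∀ a ∈ A, IsSupported k S (j a)
  dense : ∀ (F : Finset X) (y : X → Bool), (F : Set X) ⊆ S → ∃ a ∈ A, a ≠ ⊥ ∧ j a ≤ k (cyl F y)

namespace IsAdapted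

variable {j : BoundedLatticeHom B 𝔸} {k : BoundedLatticeHom (Fr X) 𝔸}
  {A A' : BooleanSubalgebra B} {S S' : Set X}

theorem exists_cyl_hom_le (hj : Function.Injective j) (hk : Function.Injective k)
    (hkd : IsDense (Set.range k)) (h : IsAdapted j k A S) {a : B} (ha : a ∈ A) (ha0 : a ≠ ⊥) :
    ∃ (F : Finset X) (y : X → Bool), (F : Set X) ⊆ S ∧ k (cyl F y) ≤ j a := by
  obtain ⟨F, y, hF⟩ := CohenAlgebra.exists_cyl_hom_le hk hkd (mt (hom_eq_bot hj).1 ha0)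
  obtain ⟨G, -, hG⟩ := h.supported a ha F y hF
  exact ⟨G, y, hG⟩

/-- The coordinates to which a subalgebra is adapted are determined by it, monotonically. -/
theorem subset_of_le (hj : Function.Injective j) (hk : Function.Injective k)
    (hkd : IsDense (Set.range k)) (h : IsAdapted j k A S) (h' : IsAdapted j k A' S')
    (hA : A ≤ A') : S ⊆ S' := by
  intro i hi
  obtain ⟨a, ha, ha0, hle⟩ := h.dense {i} (fun _ => true) (by simpa using hi)
  obtain ⟨F, y, hFS, hF⟩ := h'.exists_cyl_hom_le hj hk hkd (hA ha) ha0
  exact hFS ((cyl_le_cyl_iff.1 ((hom_le hk).1 (hF.trans hle))).1 (Finset.mem_singleton_self i))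

theorem isRegularSubalgebra (hj : Function.Injective j) (hk : Function.Injective k)
    (hkd : IsDense (Set.range k)) (h : IsAdapted j k A S) : IsRegularSubalgebra A := by
  classical
  refine isRegularSubalgebra_iff.2 fun Y hYA hY b hb => ?_
  obtain ⟨F, y, hF⟩ := CohenAlgebra.exists_cyl_hom_le hk hkd (mt (hom_eq_bot hj).1 hb)
  obtain ⟨a, ha, ha0, hle⟩ := h.dense (F.filter (· ∈ S)) y
    (fun i hi => (Finset.mem_filter.1 hi).2)
  obtain ⟨x, hx, hxa⟩ := hY a ha ha0
  obtain ⟨H, z, hHS, hH⟩ := h.exists_cyl_hom_le hj hk hkd (A.inf_mem (hYA hx) ha)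
    (mt disjoint_iff.2 hxa)
  refine ⟨x, hx, fun hxb => ?_⟩
  rw [map_inf] at hH
  have h1 : Disjoint (cyl H z) (cyl F y) := (disjoint_hom hk).1
    (((disjoint_hom hj).2 hxb).mono (hH.trans inf_le_left) hF)
  obtain ⟨i, hiH, hiF, hne⟩ := disjoint_cyl_iff.1 h1
  exact hne ((cyl_le_cyl_iff.1 ((hom_le hk).1 ((hH.trans inf_le_right).trans hle))).2 i
    (Finset.mem_filter.2 ⟨hiF, hHS hiH⟩))

theorem closure_union (hj : Function.Injective j) (hk : Function.Injective k)
    (hkd : IsDense (Set.range k)) (h : IsAdapted j k A S) (h' : IsAdapted j k A' S') :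
    IsAdapted j k (BooleanSubalgebra.closure ((A : Set B) ∪ A')) (S ∪ S') := by
  classical
  constructor
  · have hle : BooleanSubalgebra.closure ((A : Set B) ∪ A') ≤
        (supportedSubalgebra hk hkd (S ∪ S')).comap j := by
      refine BooleanSubalgebra.closure_le.2 (Set.union_subset ?_ ?_)
      · exact fun a ha => (h.supported a ha).mono Set.subset_union_left
      · exact fun a ha => (h'.supported a ha).mono Set.subset_union_right
    exact fun a ha => hle ha
  · intro F y hF
    obtain ⟨a, ha, ha0, hle⟩ := h.dense (F.filter (· ∈ S)) y
      (fun i hi => (Finset.mem_filter.1 hi).2)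
    obtain ⟨G, z, hGS, hG⟩ := h.exists_cyl_hom_le hj hk hkd ha ha0
    -- the second element is chosen compatible with the cylinder found below the first one
    obtain ⟨a', ha', ha0', hle'⟩ := h'.dense ((F ∪ G).filter (· ∈ S'))
      (fun i => if i ∈ G then z i else y i) (fun i hi => (Finset.mem_filter.1 hi).2)
    obtain ⟨G', z', hGS', hG'⟩ := h'.exists_cyl_hom_le hj hk hkd ha' ha0'
    have hz' := (cyl_le_cyl_iff.1 ((hom_le hk).1 (hG'.trans hle'))).2
    refine ⟨a ⊓ a', BooleanSubalgebra.inf_mem (BooleanSubalgebra.subset_closure (Or.inl ha))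
      (BooleanSubalgebra.subset_closure (Or.inr ha')), fun h0 => ?_, ?_⟩
    · have h1 : Disjoint (cyl G z) (cyl G' z') := (disjoint_hom hk).1
        (((disjoint_hom hj).2 (disjoint_iff.2 h0)).mono hG hG')
      obtain ⟨i, hi, hi', hne⟩ := disjoint_cyl_iff.1 h1
      have := hz' i (Finset.mem_filter.2 ⟨Finset.mem_union_right _ hi, hGS' hi'⟩)
      simp only [hi, if_true] at this
      exact hne this.symm
    · rw [map_inf]
      refine (inf_le_inf hle hle').trans ?_
      rw [← map_inf, hom_le hk]
      rintro w ⟨hw, hw'⟩ i hi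
      by_cases hiS : i ∈ S
      · exact hw i (Finset.mem_filter.2 ⟨hi, hiS⟩)
      · have hiS' : i ∈ S' := (hF hi).resolve_left hiS
        have := hw' i (Finset.mem_filter.2 ⟨Finset.mem_union_left _ hi, hiS'⟩)
        have hiG : i ∉ G := fun h => hiS (hGS h)
        simpa [hiG] using this

theorem exists_countable (hj : Function.Injective j) (hjd : IsDense (Set.range j))
    (hk : Function.Injective k) (hkd : IsDense (Set.range k)) {x : Set B} (hx : x.Countable) :
    ∃ (A : BooleanSubalgebra B) (S : Set X), (A : Set B).Countable ∧ x ⊆ A ∧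
      IsAdapted j k A S := by
  classical
  choose S hSc hS using fun b : B => exists_countable_isSupported hk hkd (j b)
  -- a cylinder is coded by its domain and the set of coordinates where it requires the value `1`
  choose c hc0 hc using fun p : Finset X × Finset X => exists_hom_le hj hjd
    (mt (hom_eq_bot hk).1 (cyl_ne_bot p.1 fun i => decide (i ∈ p.2)))
  let T : Finset B → Set (Finset X) := fun s => {F | (F : Set X) ⊆ ⋃ b ∈ s, S b}
  have hT : ∀ s, (T s).Countable := by
    intro s
    have h1 : (⋃ b ∈ s, S b).Countable := s.countable_toSet.biUnion fun b _ => hSc b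
    have := (Set.countable_ofPred_finite_subset h1).preimage_of_injOn
      (f := fun s : Finset X => (s : Set X)) Finset.coe_injective.injOn
    exact this.mono fun F hF => (⟨F.finite_toSet, hF⟩ :
      (F : Set X).Finite ∧ (F : Set X) ⊆ ⋃ b ∈ s, S b)
  obtain ⟨z, hzc, hxz, -, hz⟩ := exists_mem_closed_under (C := {z : Set B | z.Countable})
    (fun _ h => h) (fun D hD _ hDc _ => hDc.sUnion fun z hz => hD hz) (T := Set.univ)
    (fun x _ hx => ⟨x, hx, subset_rfl, Set.subset_univ x⟩)
    (fun s => (BooleanSubalgebra.closure (s : Set B) : Set B) ∪ c '' (T s ×ˢ T s))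
    (fun s => (countable_closure s.countable_toSet).union (((hT s).prod (hT s)).image c))
    (fun _ _ => Set.subset_univ _) (Set.subset_univ x) hx
  have hcl : ∀ s : Finset B, (s : Set B) ⊆ z →
      ∀ b ∈ BooleanSubalgebra.closure (s : Set B), b ∈ z := fun s hs b hb => hz s hs (Or.inl hb)
  let A : BooleanSubalgebra B :=
    { carrier := z
      bot_mem' := hcl ∅ (by simp) _ BooleanSubalgebra.bot_mem
      supClosed' := fun a ha b hb => hcl {a, b}
        (by simpa [Set.insert_subset_iff] using ⟨ha, hb⟩) _
        (BooleanSubalgebra.sup_mem (BooleanSubalgebra.subset_closure (by simp))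
          (BooleanSubalgebra.subset_closure (by simp)))
      infClosed' := fun a ha b hb => hcl {a, b}
        (by simpa [Set.insert_subset_iff] using ⟨ha, hb⟩) _
        (BooleanSubalgebra.inf_mem (BooleanSubalgebra.subset_closure (by simp))
          (BooleanSubalgebra.subset_closure (by simp)))
      compl_mem' := fun {a} ha => hcl {a} (by simpa using ha) _
        (BooleanSubalgebra.compl_mem (BooleanSubalgebra.subset_closure (by simp))) }
  refine ⟨A, ⋃ b ∈ z, S b, hzc, hxz, fun a ha => ?_, fun F y hF => ?_⟩
  · exact (hS a).mono (Set.subset_biUnion_of_mem (u := S) ha)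
  · have hb : ∀ i, ∃ b, i ∈ F → b ∈ z ∧ i ∈ S b := by
      intro i
      by_cases hi : i ∈ F
      · obtain ⟨b, hb, hib⟩ := Set.mem_iUnion₂.1 (hF hi)
        exact ⟨b, fun _ => ⟨hb, hib⟩⟩
      · exact ⟨⊥, fun h => (hi h).elim⟩
    choose b hb using hb
    have hFT : F ∈ T (F.image b) := fun i hi =>
      Set.mem_iUnion₂.2 ⟨b i, Finset.mem_image_of_mem b hi, (hb i hi).2⟩
    have hGT : F.filter (fun i => y i = true) ∈ T (F.image b) := fun i hi =>
      hFT (Finset.mem_filter.1 hi).1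
    refine ⟨c (F, F.filter fun i => y i = true), hz (F.image b) ?_ (Or.inr
      ⟨_, ⟨hFT, hGT⟩, rfl⟩), hc0 _, (hc _).trans ((hom_le hk).2 ?_)⟩
    · intro a ha
      obtain ⟨i, hi, rfl⟩ := Finset.mem_image.1 ha
      exact (hb i hi).1
    · refine cyl_le_cyl_iff.2 ⟨subset_rfl, fun i hi => ?_⟩
      simp [hi]

theorem sUnion (hj : Function.Injective j) (hk : Function.Injective k)
    (hkd : IsDense (Set.range k)) {D : Set (Set B)}
    (hD : ∀ z ∈ D, ∃ A : BooleanSubalgebra B, (A : Set B) = z ∧ ∃ S, IsAdapted j k A S)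
    (hne : D.Nonempty) (hchain : IsChain (fun x y => x ⊆ y) D) :
    ∃ A : BooleanSubalgebra B, (A : Set B) = ⋃₀ D ∧ ∃ S, IsAdapted j k A S := by
  choose! A hA S hS using hD
  have hdir : ∀ z ∈ D, ∀ w ∈ D, ∃ v ∈ D, z ⊆ v ∧ w ⊆ v := by
    intro z hz w hw
    rcases hchain.total hz hw with h | h
    exacts [⟨w, hw, h, subset_rfl⟩, ⟨z, hz, subset_rfl, h⟩]
  have hop : ∀ f : B → B → B, (∀ z ∈ D, ∀ a ∈ z, ∀ b ∈ z, f a b ∈ z) →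
      ∀ a ∈ ⋃₀ D, ∀ b ∈ ⋃₀ D, f a b ∈ ⋃₀ D := by
    rintro f hf a ⟨z, hz, ha⟩ b ⟨w, hw, hb⟩
    obtain ⟨v, hv, hzv, hwv⟩ := hdir z hz w hw
    exact ⟨v, hv, hf v hv a (hzv ha) b (hwv hb)⟩
  let A' : BooleanSubalgebra B :=
    { carrier := ⋃₀ D
      bot_mem' := by
        obtain ⟨z, hz⟩ := hne
        exact ⟨z, hz, by rw [← hA z hz]; exact (A z).bot_mem⟩
      supClosed' := fun a ha b hb => hop (· ⊔ ·) (fun z hz a ha b hb => by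
        rw [← hA z hz] at ha hb ⊢
        exact (A z).sup_mem ha hb) a ha b hb
      infClosed' := fun a ha b hb => hop (· ⊓ ·) (fun z hz a ha b hb => by
        rw [← hA z hz] at ha hb ⊢
        exact (A z).inf_mem ha hb) a ha b hb
      compl_mem' := by
        rintro a ⟨z, hz, ha⟩
        refine ⟨z, hz, ?_⟩
        rw [← hA z hz] at ha ⊢
        exact (A z).compl_mem ha }
  refine ⟨A', rfl, ⋃ z ∈ D, S z, ?_, ?_⟩
  · rintro a ⟨z, hz, ha⟩
    rw [← hA z hz] at ha
    exact ((hS z hz).supported a ha).mono (Set.subset_biUnion_of_mem (u := S) hz)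
  · intro F y hF
    have hdirS : DirectedOn (fun z w => S z ⊆ S w) D := by
      intro z hz w hw
      obtain ⟨v, hv, hzv, hwv⟩ := hdir z hz w hw
      have hle : ∀ z ∈ D, z ⊆ v → A z ≤ A v := by
        intro z hz h a ha
        rw [← SetLike.mem_coe, hA v hv]
        rw [← SetLike.mem_coe, hA z hz] at ha
        exact h ha
      exact ⟨v, hv, (hS z hz).subset_of_le hj hk hkd (hS v hv) (hle z hz hzv),
        (hS w hw).subset_of_le hj hk hkd (hS v hv) (hle w hw hwv)⟩
    obtain ⟨z, hz, hFz⟩ := hdirS.exists_mem_subset_of_finset_subset_biUnion hne hF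
    obtain ⟨a, ha, h⟩ := (hS z hz).dense F y hFz
    exact ⟨a, ⟨z, hz, by rw [← hA z hz]; exact ha⟩, h⟩

end IsAdapted

/-- The countable subalgebras adapted to some set of coordinates form a regular club. -/
theorem exists_isRegularClub {j : BoundedLatticeHom B 𝔸} {k : BoundedLatticeHom (Fr X) 𝔸}
    (hj : Function.Injective j) (hjd : IsDense (Set.range j)) (hk : Function.Injective k)
    (hkd : IsDense (Set.range k)) : ∃ C : Set (Set B), IsRegularClub C := by
  refine ⟨{z | z.Countable ∧ ∃ A : BooleanSubalgebra B, (A : Set B) = z ∧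
    ∃ S, IsAdapted j k A S}, ⟨fun z hz => hz.1, fun x hx => ?_, fun D hD hne hDc hchain => ?_⟩,
    ?_, ?_⟩
  · obtain ⟨A, S, hA, hxA, h⟩ := IsAdapted.exists_countable hj hjd hk hkd hx
    exact ⟨A, ⟨hA, A, rfl, S, h⟩, hxA⟩
  · exact ⟨hDc.sUnion fun z hz => (hD hz).1,
      IsAdapted.sUnion hj hk hkd (fun z hz => (hD hz).2) hne hchain⟩
  · rintro _ ⟨-, A, rfl, S, h⟩
    exact ⟨A, rfl, h.isRegularSubalgebra hj hk hkd⟩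
  · rintro _ ⟨hc, A, rfl, S, h⟩ _ ⟨hc', A', rfl, S', h'⟩
    exact ⟨countable_closure (hc.union hc'), _, rfl, S ∪ S', h.closure_union hj hk hkd h'⟩

theorem IsCohen.exists_isRegularClub (h : IsCohen B) : ∃ C : Set (Set B), IsRegularClub C := by
  obtain ⟨X, -, ⟨e⟩⟩ := h
  obtain ⟨𝔸, _, j, hj, hjd, ⟨e₁⟩⟩ := exists_denseEmbedding B
  obtain ⟨𝔹, _, k, hk, hkd, ⟨e₂⟩⟩ := exists_denseEmbedding (Fr X)
  have f : 𝔸 ≃o 𝔹 := (e₁.symm.trans e).trans e₂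
  refine CohenAlgebra.exists_isRegularClub
    (j := homOfInfCompl (fun b => f (j b)) (fun a b => by rw [map_inf, map_inf])
      fun a => by rw [map_compl', map_compl']) (fun a b hab => hj (f.injective hab)) ?_ hk hkd
  intro x hx
  obtain ⟨b, hb, hle⟩ := exists_hom_le hj hjd (x := f.symm x) (by simpa using hx)
  refine ⟨f (j b), ⟨b, rfl⟩, ?_, ?_⟩
  · simpa [hom_eq_bot hj] using hb
  · simpa using f.monotone hle

end Support

end CohenAlgebra

theorem theorem3p2 (B : Type u) [BooleanAlgebra B] [Infinite B]
    (hB : CohenAlgebra.HasUniformDensity B) :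
    CohenAlgebra.IsCohen B ↔
      ∃ C : Set (Set B),
        CohenAlgebra.IsClosedUnbounded C ∧
        (∀ x ∈ C, ∃ A : BooleanSubalgebra B,
          (A : Set B) = x ∧ CohenAlgebra.IsRegularSubalgebra A) ∧
        (∀ A₁ ∈ C, ∀ A₂ ∈ C, (BooleanSubalgebra.closure (A₁ ∪ A₂) : Set B) ∈ C) := by
  constructor
  · intro h
    obtain ⟨C, hC⟩ := h.exists_isRegularClub
    exact ⟨C, hC.toIsClosedUnbounded, hC.regular, hC.join⟩
  · rintro ⟨C, hC, hreg, hjoin⟩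
    exact CohenAlgebra.IsRegularClub.isCohen ⟨hC, hreg, hjoin⟩ hB
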